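/- Let $A$ be a complete Noetherian local ring of dimension $d \ge 2$ which is equidimensional, i.e. $\dim(A/\mathfrak p)=d$ for every minimal prime $\mathfrak p$ of $A$. For $1\le t\le d-1$ let $\Gamma_t(A)$ be the graph whose vertices are the minimal primes of $A$, with an edge between distinct vertices $\mathfrak p,\mathfrak q$ if and only if $\operatorname{ht}_A(\mathfrak p+\mathfrak q)\le t$. Let $c(A)$ be the connectedness dimension of $A$, i.e. the minimum of $\dim X$ over all closed subsets $X\subseteq\operatorname{Spec}(A)$ for which $\operatorname{Spec}(A)\setminus X$ is disconnected, where the empty set is considered disconnected. Write $\#$ for the number of connected components of a graph or of a topological space. (1) For every $1\le t\le d-1$, the graph $\Gamma_t(A)$ is connected if and only if $c(A)\ge d-t$. Consequently, if $A$ has at least two minimal primes, then $$c(A)=\max\{\, i \;:\; 1\le i\le d-1,\ \Gamma_{d-i}(A)\text{ is connected}\,\},$$ where the maximum of the empty set is taken to be $0$; and if $A$ has exactly one minimal prime, then $c(A)=d$. (2) For every $1\le t\le d-1$, $$\#\Gamma_t(A)=\max\{\,\#(\operatorname{Spec}(A)\setminus X)\;:\; X\subseteq\operatorname{Spec}(A)\text{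 closed},\ \dim X\le d-t-1\,\}.$$ -/

import Mathlib

/-- A commutative ring `A` is equidimensional if `dim (A / p) = dim A` for every minimal prime `p`. -/
def IsEquidimensionalRing (A : Type*) [CommRing A] : Prop :=
  ∀ p ∈ minimalPrimes A, ringKrullDim (A ⧸ p) = ringKrullDim A

/-- The dimensions of the closed subsets `X` of `Spec A` for which `Spec A \ X` is disconnected.
The empty set counts as disconnected (`IsConnected` includes non-emptiness). -/
def disconnectingDims (A : Type*) [CommRing A] : Set (WithBot ℕ∞) :=
  {n | ∃ X : Set (PrimeSpectrum A), IsClosed X ∧ ¬ IsConnected Xᶜ ∧ n = topologicalKrullDim X}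

/-- The connectedness dimension `c(A)`: the minimal dimension of a closed subset of `Spec A` whose
complement is disconnected. -/
noncomputable def connectednessDim (A : Type*) [CommRing A] : WithBot ℕ∞ :=
  sInf (disconnectingDims A)

/-- The infimum in the definition of `c(A)` is always attained, i.e. it is a minimum. -/
theorem connectednessDim_isLeast (A : Type*) [CommRing A] :
    IsLeast (disconnectingDims A) (connectednessDim A) := by
  have hne : (disconnectingDims A).Nonempty :=
    ⟨_, Set.univ, isClosed_univ, by simp [IsConnected], rfl⟩
  exact ⟨csInf_mem hne, fun _ h => sInf_le h⟩

/-- The graph `Γ_t(A)`: its vertices are the minimal primes of `A`, and distinct vertices `p`, `q`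
are joined by an edge if and only if the height of the ideal `p + q` is at most `t`. -/
def minimalPrimesGraph (A : Type*) [CommRing A] (t : ℕ) : SimpleGraph (minimalPrimes A) where
  Adj p q := p ≠ q ∧ (p.1 + q.1).height ≤ (t : ℕ∞)
  symm := ⟨fun p q h => ⟨h.1.symm, by rw [add_comm]; exact h.2⟩⟩
  loopless := ⟨fun _ h => h.1 rfl⟩

/-!
Let `B` be a complete local domain and `P` a prime of `B` of height one. A coefficient ring of `B`,
together with a system of parameters starting inside `P`, presents `B` as a finite extension of a
power series ring over a field or a complete discrete valuation ring. That ring is normal and has a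
prime element `π` lying in `P`, so by going-down `P` contracts to `(π)`, whence
`dim (B / P) ≥ dim B - 1`. Induction on the height gives the dimension formula
`dim (A / P) + ht P = dim A`, first for complete local domains and then for complete equidimensional
local rings.

By the formula, `ht (p + q) ≤ t` says that `V(p + q)` has dimension at least `d - t`, so `V(p + q)`
is not contained in any closed `X` of dimension less than `d - t`, and adjacent minimal primes lie
in the same component of `Spec A \ X`. Conversely, removing the union of the `V(p + q)` over all
`p`, `q` in distinct components of `Γ_t(A)` separates these components.
-/

open IsLocalRing

/-! ### Completeness -/

section Completeness

variable {R : Type*} [CommRing R] (I : Ideal R)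

theorem isPrecomplete_iff_exists_sub_mem_pow :
    IsPrecomplete I R ↔
      ∀ f : ℕ → R, (∀ n, f (n + 1) - f n ∈ I ^ n) → ∃ L, ∀ n, L - f n ∈ I ^ n := by
  have hmem {x y : R} {n : ℕ} : x ≡ y [SMOD (I ^ n • ⊤ : Submodule R R)] ↔ y - x ∈ I ^ n := by
    rw [SModEq.comm, SModEq.sub_mem, smul_eq_mul, Ideal.mul_top]
  refine ⟨fun h f hf => ?_, fun h => ⟨fun f hf => ?_⟩⟩
  · obtain ⟨L, hL⟩ := h.prec
      fun hmn => (AdicCompletion.isAdicCauchy_iff I R f).mpr (fun n => hmem.mpr (hf n)) hmn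
    exact ⟨L, fun n => hmem.mp (hL n)⟩
  · obtain ⟨L, hL⟩ := h f fun n => hmem.mp (hf n.le_succ)
    exact ⟨L, fun n => hmem.mpr (hL n)⟩

theorem isPrecomplete_of_finite [IsPrecomplete I R] (M : Type*) [AddCommGroup M] [Module R M]
    [Module.Finite R M] : IsPrecomplete I M := by
  rw [← AdicCompletion.of_surjective_iff]
  intro y
  obtain ⟨z, rfl⟩ := AdicCompletion.ofTensorProduct_surjective_of_finite I M y
  induction z with
  | zero => exact ⟨0, by simp only [map_zero]⟩
  | add z w hz hw =>
    obtain ⟨a, ha⟩ := hz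
    obtain ⟨b, hb⟩ := hw
    exact ⟨a + b, by rw [map_add, map_add, ha, hb]⟩
  | tmul r m =>
    obtain ⟨s, rfl⟩ := AdicCompletion.of_surjective I R r
    exact ⟨s • m, by rw [AdicCompletion.ofTensorProduct_tmul]; rfl⟩

theorem isAdicComplete_quotient_of_isLocalRing {A : Type*} [CommRing A] [IsLocalRing A]
    [IsNoetherianRing A] [IsAdicComplete (maximalIdeal A) A] (I : Ideal A)
    [IsLocalRing (A ⧸ I)] : IsAdicComplete (maximalIdeal (A ⧸ I)) (A ⧸ I) := by
  have hmap : (maximalIdeal A).map (algebraMap A (A ⧸ I)) = maximalIdeal (A ⧸ I) :=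
    map_maximalIdeal_of_surjective _ Ideal.Quotient.mk_surjective
  have : IsPrecomplete (maximalIdeal (A ⧸ I)) (A ⧸ I) := by
    rw [← hmap, IsPrecomplete.map_algebraMap_iff]
    exact isPrecomplete_of_finite _ _
  exact {}

end Completeness

section FiniteOverComplete

variable {R B : Type*} [CommRing R] [CommRing B] [Algebra R B]

theorem exists_mem_span_sub_mem_mul_span {J : Ideal B}
    (hJ : ∀ b : B, ∃ r : R, b - algebraMap R B r ∈ J) (T : Set B) {z : B}
    (hz : z ∈ Ideal.span T) :
    ∃ y ∈ Submodule.span R T, z - y ∈ J * Ideal.span T := by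
  induction hz using Submodule.span_induction with
  | mem x hx => exact ⟨x, Submodule.subset_span hx, by simp only [sub_self, zero_mem]⟩
  | zero => exact ⟨0, zero_mem _, by simp only [sub_self, zero_mem]⟩
  | add x y _ _ hx hy =>
    obtain ⟨a, ha, ha'⟩ := hx
    obtain ⟨b, hb, hb'⟩ := hy
    exact ⟨a + b, add_mem ha hb, by simpa only [add_sub_add_comm] using add_mem ha' hb'⟩
  | smul b x hxT hx =>
    obtain ⟨a, ha, ha'⟩ := hx
    obtain ⟨r, hr⟩ := hJ b
    refine ⟨r • a, Submodule.smul_mem _ _ ha, ?_⟩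
    have hsplit : b • x - r • a = (b - algebraMap R B r) * x + algebraMap R B r * (x - a) := by
      rw [smul_eq_mul, Algebra.smul_def]; ring
    rw [hsplit]
    exact add_mem (Ideal.mul_mem_mul hr hxT) (Ideal.mul_mem_left _ _ ha')

theorem exists_fg_forall_exists_sub_mem_pow [IsNoetherianRing B] {J : Ideal B}
    (hJ : ∀ b : B, ∃ r : R, b - algebraMap R B r ∈ J) (k : ℕ) :
    ∃ N : Submodule R B, N.FG ∧ ∀ b : B, ∃ y ∈ N, b - y ∈ J ^ k := by
  induction k with
  | zero => exact ⟨⊥, Submodule.fg_bot, fun b => ⟨0, zero_mem _, by simp⟩⟩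
  | succ k ih =>
    obtain ⟨N, hN, hN'⟩ := ih
    obtain ⟨T, hT⟩ := IsNoetherian.noetherian (J ^ k)
    refine ⟨N ⊔ Submodule.span R T, hN.sup (Submodule.fg_span T.finite_toSet), fun b => ?_⟩
    obtain ⟨y, hy, hby⟩ := hN' b
    obtain ⟨w, hw, hbw⟩ := exists_mem_span_sub_mem_mul_span hJ (T : Set B) (hT.symm ▸ hby)
    refine ⟨y + w, Submodule.add_mem_sup hy hw, ?_⟩
    rwa [Ideal.span, hT, ← pow_succ', sub_sub] at hbw

theorem moduleFinite_of_maximalIdeal_pow_le_map [IsLocalRing R] [IsPrecomplete (maximalIdeal R) R]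
    [IsLocalRing B] [IsNoetherianRing B]
    (hres : ∀ b : B, ∃ r : R, b - algebraMap R B r ∈ maximalIdeal B)
    (hle : (maximalIdeal R).map (algebraMap R B) ≤ maximalIdeal B) {k : ℕ}
    (hk : maximalIdeal B ^ k ≤ (maximalIdeal R).map (algebraMap R B)) : Module.Finite R B := by
  obtain ⟨N, hN, happrox⟩ := exists_fg_forall_exists_sub_mem_pow hres k
  have : Module.Finite R N := Module.Finite.iff_fg.mpr hN
  have : IsPrecomplete (maximalIdeal R) N := isPrecomplete_of_finite _ _
  have : IsHausdorff (maximalIdeal R) B := by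
    rw [← IsHausdorff.map_algebraMap_iff (S := B)]
    exact .of_le_jacobson _ _ (hle.trans (maximalIdeal_le_jacobson _))
  have hsurj : Function.Surjective N.subtype := by
    refine surjective_of_mkQ_comp_surjective (I := maximalIdeal R) fun y => ?_
    obtain ⟨b, rfl⟩ := Submodule.mkQ_surjective _ y
    obtain ⟨y, hy, hby⟩ := happrox b
    refine ⟨⟨y, hy⟩, ?_⟩
    rw [LinearMap.comp_apply, Submodule.subtype_apply, eq_comm, Submodule.mkQ_apply,
      Submodule.mkQ_apply, Submodule.Quotient.eq, Ideal.smul_top_eq_map]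
    exact hk hby
  exact Module.Finite.of_surjective _ hsurj

end FiniteOverComplete

/-! ### Power series rings -/

section PowerSeries

open PowerSeries

variable {S : Type*} [CommRing S]

theorem mem_map_C_sup_span_X_pow_iff (I : Ideal S) (n : ℕ) (f : S⟦X⟧) :
    f ∈ (I.map C ⊔ Ideal.span {X}) ^ n ↔ ∀ j, coeff j f ∈ I ^ (n - j) := by
  set M : Ideal S⟦X⟧ := I.map C ⊔ Ideal.span {X}
  have hX : X ∈ M := Ideal.mem_sup_right (Ideal.mem_span_singleton_self _)
  constructor
  · have hcoeff_zero : ∀ h ∈ M, coeff 0 h ∈ I := by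
      suffices M ≤ I.comap constantCoeff from fun h hh => by simpa using this hh
      refine sup_le (Ideal.map_le_iff_le_comap.mpr fun s hs => by simpa using hs) ?_
      simp [Ideal.span_le]
    intro hf j
    induction n generalizing f j with
    | zero => simp
    | succ n ih =>
      rw [pow_succ] at hf
      refine Submodule.mul_induction_on hf (fun g hg h hh => ?_) fun g h hg hh => ?_
      · rw [coeff_mul]
        refine sum_mem fun ⟨a, b⟩ hab => ?_
        rw [Finset.HasAntidiagonal.mem_antidiagonal] at hab
        rcases b.eq_zero_or_pos with rfl | hb
        · have := Ideal.mul_mem_mul (ih g hg a) (hcoeff_zero h hh)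
          rw [← pow_succ] at this
          exact Ideal.pow_le_pow_right (by omega) this
        · exact Ideal.mul_mem_right _ _ (Ideal.pow_le_pow_right (by omega) (ih g hg a))
      · rw [map_add]
        exact add_mem hg hh
  · intro hf
    rw [← sub_add_cancel f (∑ j ∈ Finset.range n, C (coeff j f) * X ^ j)]
    refine add_mem ?_ (sum_mem fun j hj => ?_)
    · suffices X ^ n ∣ f - ∑ j ∈ Finset.range n, C (coeff j f) * X ^ j from
        Ideal.mem_of_dvd _ this (Ideal.pow_mem_pow hX n)
      rw [X_pow_dvd_iff]
      intro m hm
      simp [coeff_C_mul, coeff_X_pow, hm]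
    · have hC : C (coeff j f) ∈ M ^ (n - j) := by
        refine Ideal.pow_right_mono le_sup_left _ ?_
        rw [← Ideal.map_pow]
        exact Ideal.mem_map_of_mem _ (hf j)
      rw [← Nat.sub_add_cancel (Finset.mem_range.mp hj).le, pow_add]
      exact Ideal.mul_mem_mul hC (Ideal.pow_mem_pow hX j)

theorem isPrecomplete_map_C_sup_span_X (I : Ideal S) [IsPrecomplete I S] :
    IsPrecomplete (I.map C ⊔ Ideal.span {X}) S⟦X⟧ := by
  simp only [isPrecomplete_iff_exists_sub_mem_pow, mem_map_C_sup_span_X_pow_iff, map_sub]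
  intro f hf
  have hlim : ∀ j, ∃ L, ∀ n, L - coeff j (f (n + j)) ∈ I ^ n := fun j => by
    refine (isPrecomplete_iff_exists_sub_mem_pow I).mp ‹_› _ fun n => ?_
    have := hf (n + j) j
    rwa [Nat.add_sub_cancel, Nat.add_right_comm] at this
  choose L hL using hlim
  refine ⟨mk L, fun n j => ?_⟩
  rcases le_total j n with h | h
  · simpa only [coeff_mk, Nat.sub_add_cancel h] using hL j (n - j)
  · simp only [Nat.sub_eq_zero_of_le h, pow_zero, Ideal.one_eq_top, Submodule.mem_top]

theorem mem_maximalIdeal_powerSeries_iff [IsLocalRing S] {f : S⟦X⟧} :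
    f ∈ maximalIdeal S⟦X⟧ ↔ constantCoeff f ∈ maximalIdeal S := by
  simp only [IsLocalRing.mem_maximalIdeal, mem_nonunits_iff, isUnit_iff_constantCoeff]

theorem maximalIdeal_powerSeries [IsLocalRing S] :
    maximalIdeal S⟦X⟧ = (maximalIdeal S).map C ⊔ Ideal.span {X} := by
  ext f
  rw [mem_maximalIdeal_powerSeries_iff, ← pow_one (_ ⊔ _), mem_map_C_sup_span_X_pow_iff]
  refine ⟨fun h j => ?_, fun h => by simpa using h 0⟩
  cases j with
  | zero => simpa using h
  | succ j => simp

theorem exists_powerSeries_ringHom_eval {B : Type*} [CommRing B] [IsLocalRing B]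
    [IsAdicComplete (maximalIdeal B) B] (f : S →+* B) {x : B} (hx : x ∈ maximalIdeal B) :
    ∃ F : S⟦X⟧ →+* B, F X = x ∧ ∀ s, F (C s) = f s := by
  let : WithIdeal B := ⟨maximalIdeal B⟩
  let : UniformSpace S := ⊥
  have : DiscreteTopology S := ⟨rfl⟩
  have hB := (IsAdic.isAdicComplete_iff (I := maximalIdeal B) rfl).mp inferInstance
  have := hB.1
  have := hB.2
  have hf : Continuous f := continuous_of_discreteTopology
  have hx' : HasEval x := by
    rw [hasEval_def, IsTopologicallyNilpotent]
    refine (Ideal.hasBasis_nhds_zero_adic (maximalIdeal B)).tendsto_right_iff.mpr ?_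
    intro i _
    filter_upwards [Filter.eventually_ge_atTop i] with n hn
    exact Ideal.pow_le_pow_right hn (Ideal.pow_mem_pow hx n)
  refine ⟨eval₂Hom hf hx', ?_, fun s => ?_⟩
  · rw [coe_eval₂Hom, eval₂_X]
  · rw [coe_eval₂Hom, eval₂_C]

theorem ringKrullDim_powerSeries [IsNoetherianRing S] [IsLocalRing S] :
    ringKrullDim S⟦X⟧ = ringKrullDim S + 1 := by
  have hX : (X : S⟦X⟧) ∈ maximalIdeal S⟦X⟧ := by
    rw [mem_maximalIdeal_powerSeries_iff, constantCoeff_X]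
    exact zero_mem _
  have hker : RingHom.ker (constantCoeff (R := S)) = Ideal.span {X} := by
    ext f
    rw [RingHom.mem_ker, Ideal.mem_span_singleton, X_dvd_iff]
  rw [← ringKrullDim_quotient_span_singleton_succ_eq_ringKrullDim_of_mem_nonZeroDivisors
    (x := (X : S⟦X⟧)) MvPowerSeries.X_mem_nonzeroDivisors hX, ← hker, ringKrullDim_eq_of_ringEquiv
    (RingHom.quotientKerEquivOfSurjective (constantCoeff_surj (R := S)))]

theorem ker_powerSeries_map_mk_span_singleton (π : S) :
    RingHom.ker (map (Ideal.Quotient.mk (Ideal.span {π}))) = Ideal.span {C π} := by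
  ext f
  have hcoeff : f ∈ RingHom.ker (map (Ideal.Quotient.mk (Ideal.span {π}))) ↔
      ∀ n, π ∣ coeff n f := by
    simp only [RingHom.mem_ker, PowerSeries.ext_iff, coeff_map, map_zero,
      Ideal.Quotient.eq_zero_iff_dvd]
  rw [hcoeff, Ideal.mem_span_singleton]
  constructor
  · intro h
    choose c hc using h
    exact ⟨mk c, by ext n; rw [coeff_C_mul, coeff_mk, hc]⟩
  · rintro ⟨g, rfl⟩ n
    exact ⟨coeff n g, coeff_C_mul n g π⟩

theorem prime_powerSeries_C {π : S} (hπ : Prime π) : Prime (C π : S⟦X⟧) := by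
  have : (Ideal.span {π}).IsPrime := (Ideal.span_singleton_prime hπ.ne_zero).mpr hπ
  rw [← Ideal.span_singleton_prime (map_ne_zero_iff _ C_injective |>.mpr hπ.ne_zero),
    ← ker_powerSeries_map_mk_span_singleton]
  exact RingHom.ker_isPrime _

end PowerSeries

section Normality

open PowerSeries

variable {R K : Type*} [CommRing R] [IsDomain R] [CommRing K] [Algebra R K]

theorem isAlmostIntegral_powerSeries_C {a : K} (ha : IsAlmostIntegral R a) :
    IsAlmostIntegral R⟦X⟧ (C a) := by
  obtain ⟨r, hr, hra⟩ := ha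
  refine ⟨C r, mem_nonZeroDivisors_of_ne_zero ?_, fun n => ?_⟩
  · exact (map_ne_zero_iff _ C_injective).mpr (nonZeroDivisors.ne_zero hr)
  · obtain ⟨s, hs⟩ := hra n
    refine ⟨C s, ?_⟩
    rw [Algebra.smul_def] at hs ⊢
    simp only [RingHom.algebraMap_toAlgebra, map_C, hs, map_mul, map_pow]

variable [IsDomain K] [FaithfulSMul R K]

theorem isAlmostIntegral_constantCoeff_divXPowOrder {p : K⟦X⟧} (hp : IsAlmostIntegral R⟦X⟧ p) :
    IsAlmostIntegral R (constantCoeff p.divXPowOrder) := by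
  have hlead (s : R⟦X⟧) : constantCoeff (algebraMap R⟦X⟧ K⟦X⟧ s).divXPowOrder =
      algebraMap R K (coeff (algebraMap R⟦X⟧ K⟦X⟧ s).order.toNat s) := by
    rw [constantCoeff_divXPowOrder]
    exact coeff_map ..
  obtain ⟨c, hc, hcp⟩ := hp
  refine ⟨coeff (algebraMap R⟦X⟧ K⟦X⟧ c).order.toNat c, mem_nonZeroDivisors_of_ne_zero ?_,
    fun n => ?_⟩
  · refine ne_zero_of_map (f := algebraMap R K) ?_
    rw [← hlead, Ne, constantCoeff_divXPowOrder_eq_zero_iff]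
    exact (map_ne_zero_iff _ (map_injective _ (FaithfulSMul.algebraMap_injective R K))).mpr
      (nonZeroDivisors.ne_zero hc)
  · obtain ⟨s, hs⟩ := hcp n
    refine ⟨coeff (algebraMap R⟦X⟧ K⟦X⟧ s).order.toNat s, ?_⟩
    rw [Algebra.smul_def, ← hlead, ← hlead, hs, Algebra.smul_def, divXPowOrder_mul,
      divXPowOrder_pow, map_mul, map_pow]

theorem isAlmostIntegral_coeff {p : K⟦X⟧} (hp : IsAlmostIntegral R⟦X⟧ p) (i : ℕ) :
    IsAlmostIntegral R (coeff i p) := by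
  induction i using Nat.strong_induction_on with
  | _ i ih =>
    let q := p - ∑ j ∈ Finset.range i, C (coeff j p) * X ^ j
    have hq : IsAlmostIntegral R⟦X⟧ q := by
      rw [← mem_completeIntegralClosure]
      refine sub_mem hp (sum_mem fun j hj => mul_mem ?_ ?_)
      · exact isAlmostIntegral_powerSeries_C (ih j (Finset.mem_range.mp hj))
      · refine pow_mem ?_ j
        exact ⟨1, one_mem _, fun n => ⟨X ^ n, by simp [RingHom.algebraMap_toAlgebra]⟩⟩
    have hcoeff_lt : ∀ m < i, coeff m q = 0 := fun m hm => by
      simp [q, coeff_C_mul, coeff_X_pow, hm]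
    have hcoeff : coeff i q = coeff i p := by
      simp [q, coeff_C_mul, coeff_X_pow]
    rw [← hcoeff]
    by_cases h0 : coeff i q = 0
    · rw [h0]
      exact zero_mem (completeIntegralClosure R K)
    · have horder : q.order = i := order_eq_nat.mpr ⟨h0, hcoeff_lt⟩
      simpa [constantCoeff_divXPowOrder, horder] using
        isAlmostIntegral_constantCoeff_divXPowOrder hq

end Normality

theorem isIntegrallyClosed_powerSeries (R : Type*) [CommRing R] [IsDomain R] [IsNoetherianRing R]
    [IsIntegrallyClosed R] : IsIntegrallyClosed (PowerSeries R) := by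
  let K := FractionRing R
  let L := FractionRing (PowerSeries K)
  have hinj : Function.Injective (algebraMap (PowerSeries R) L) := by
    rw [IsScalarTower.algebraMap_eq (PowerSeries R) (PowerSeries K) L]
    exact (IsFractionRing.injective (PowerSeries K) L).comp
      (PowerSeries.map_injective _ (IsFractionRing.injective R K))
  rw [isIntegrallyClosed_iff (FractionRing (PowerSeries R))]
  intro x hx
  let φ : FractionRing (PowerSeries R) →ₐ[PowerSeries R] L := 
    IsFractionRing.liftAlgHom (g := Algebra.ofId (PowerSeries R) L) hinj
  obtain ⟨p, hp⟩ := IsIntegrallyClosed.isIntegral_iff.mp ((hx.map φ).tower_top (A := PowerSeries K))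
  have hp_int : IsIntegral (PowerSeries R) p := by
    rw [← isIntegral_algebraMap_iff (IsFractionRing.injective (PowerSeries K) L), hp]
    exact hx.map φ
  have hp_almost : IsAlmostIntegral (PowerSeries R) p := by
    refine hp_int.isAlmostIntegral_of_exists_smul_mem_range ?_
    obtain ⟨a, b, hb, rfl⟩ := IsFractionRing.div_surjective (A := PowerSeries R) x
    refine ⟨b, hb, a, IsFractionRing.injective (PowerSeries K) L ?_⟩
    rw [Algebra.smul_def, map_mul, hp, map_div₀, AlgHom.commutes, AlgHom.commutes,
      ← IsScalarTower.algebraMap_apply, ← IsScalarTower.algebraMap_apply, mul_div_cancel₀]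
    exact (map_ne_zero_iff _ hinj).mpr (nonZeroDivisors.ne_zero hb)
  have hcoeff (i : ℕ) : ∃ r : R, algebraMap R K r = PowerSeries.coeff i p :=
    IsIntegrallyClosed.isIntegral_iff.mp (isAlmostIntegral_coeff hp_almost i).isIntegral
  choose r hr using hcoeff
  refine ⟨PowerSeries.mk r, φ.toRingHom.injective ?_⟩
  change φ _ = φ x
  rw [AlgHom.commutes, IsScalarTower.algebraMap_apply (PowerSeries R) (PowerSeries K) L, ← hp]
  congr 1
  ext i
  simp [RingHom.algebraMap_toAlgebra, hr]

/-! ### Krull dimension and integral extensions -/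

theorem ringKrullDim_le_of_isIntegral (R S : Type*) [CommRing R] [CommRing S] [Algebra R S]
    [Algebra.IsIntegral R S] : ringKrullDim S ≤ ringKrullDim R :=
  Order.krullDim_le_of_strictMono (PrimeSpectrum.comap (algebraMap R S)) fun P Q h =>
    Ideal.IsIntegral.comap_lt_comap (I := P.asIdeal) (J := Q.asIdeal) h

theorem ringKrullDim_eq_of_isIntegral (R S : Type*) [CommRing R] [CommRing S] [Algebra R S]
    [FaithfulSMul R S] [Algebra.IsIntegral R S] : ringKrullDim S = ringKrullDim R := by
  refine le_antisymm (ringKrullDim_le_of_isIntegral R S) (iSup_le fun l => ?_)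
  have hker : (⊥ : Ideal S).comap (algebraMap R S) ≤ l.head.asIdeal := by
    rw [← RingHom.ker_eq_comap_bot, (RingHom.injective_iff_ker_eq_bot _).mp
      (FaithfulSMul.algebraMap_injective R S)]
    exact bot_le
  obtain ⟨P, -, _, hP⟩ := Ideal.exists_ideal_over_prime_of_isIntegral l.head.asIdeal ⊥ hker
  have : P.LiesOver l.head.asIdeal := ⟨hP.symm⟩
  obtain ⟨L, hL, -, -⟩ := Ideal.exists_ltSeries_of_hasGoingUp l P
  rw [← hL]
  exact le_iSup (fun L : LTSeries (PrimeSpectrum S) => (L.length : WithBot ℕ∞)) L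

section GoingDown

variable {R B : Type*} [CommRing R] [CommRing B] [IsDomain B] [Algebra R B]
  [FaithfulSMul R B] [Algebra.IsIntegral R B]

theorem liesOver_of_height_le_one_of_mem [IsIntegrallyClosed R] {P : Ideal B} [P.IsPrime]
    (hP : P.height ≤ 1) {p : Ideal R} [p.IsPrime] (hp : p ≠ ⊥) (hpP : p ≤ P.under R) :
    P.LiesOver p := by
  obtain ⟨Q, hQP, hQ, hQp⟩ := Ideal.exists_ideal_le_liesOver_of_le (p := p) P hpP
  rcases hQP.eq_or_lt with rfl | hlt
  · exact hQp
  · have hQ0 : Q = ⊥ := by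
      have := (Ideal.height_add_one_le_of_lt_of_isPrime hlt).trans hP
      rw [← Ideal.height_eq_zero_iff_eq_bot, ← nonpos_iff_eq_zero,
        ← ENat.add_le_add_iff_right ENat.one_ne_top]
      rwa [zero_add]
    refine absurd ?_ hp
    rw [hQp.over, hQ0, Ideal.under_bot]

theorem ringKrullDim_le_quotient_add_one_of_prime_mem [IsDomain R] [IsNoetherianRing R]
    [IsLocalRing R] [IsIntegrallyClosed R] {P : Ideal B} [P.IsPrime] (hP : P.height ≤ 1) {π : R}
    (hπ : Prime π) (hπP : algebraMap R B π ∈ P) : ringKrullDim B ≤ ringKrullDim (B ⧸ P) + 1 := by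
  have : (Ideal.span {π}).IsPrime := (Ideal.span_singleton_prime hπ.ne_zero).mpr hπ
  have : P.LiesOver (Ideal.span {π}) := liesOver_of_height_le_one_of_mem hP
    (Ideal.span_singleton_eq_bot.not.mpr hπ.ne_zero)
    ((Ideal.span_singleton_le_iff_mem _).mpr hπP)
  rw [ringKrullDim_eq_of_isIntegral (R ⧸ Ideal.span {π}) (B ⧸ P), ringKrullDim_eq_of_isIntegral R B]
  exact (ringKrullDim_quotient_span_singleton_succ_eq_ringKrullDim_of_mem_nonZeroDivisors
    (mem_nonZeroDivisors_of_ne_zero hπ.ne_zero) hπ.not_isUnit).ge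

end GoingDown

/-! ### Systems of parameters -/

section SystemOfParameters

variable {B : Type*} [CommRing B] [IsLocalRing B] [IsNoetherianRing B]

theorem exists_ringKrullDim_eq_natCast (B : Type*) [CommRing B] [IsLocalRing B]
    [IsNoetherianRing B] : ∃ n : ℕ, ringKrullDim B = n := by
  refine ⟨(maximalIdeal B).height.toNat, ?_⟩
  rw [← maximalIdeal_height_eq_ringKrullDim, ← WithBot.coe_natCast,
    ENat.natCast_toNat Ideal.height_ne_top_of_isPrime]

theorem ringKrullDim_quotient_sup_span_singleton_add_one {I : Ideal B} {a : B}
    (haI : ∀ p ∈ I.minimalPrimes, a ∉ p) (ha : a ∈ maximalIdeal B) :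
    ringKrullDim (B ⧸ I ⊔ Ideal.span {a}) + 1 = ringKrullDim (B ⧸ I) := by
  have hsupp : Module.support B (QuotSMulTop a (B ⧸ I)) =
      Module.support B (B ⧸ I ⊔ Ideal.span {a}) := by
    rw [Module.support_quotSMulTop]
    simp only [Module.support_eq_zeroLocus, Ideal.annihilator_quotient,
      PrimeSpectrum.zeroLocus_sup, PrimeSpectrum.zeroLocus_span]
  rw [← Module.supportDim_quotient_eq_ringKrullDim I,
    ← Module.supportDim_quotSMulTop_succ_eq_of_notMem_minimalPrimes_of_mem_maximalIdeal
      (M := B ⧸ I) (by rwa [Ideal.annihilator_quotient]) ha,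
    ← Module.supportDim_quotient_eq_ringKrullDim, Module.supportDim, Module.supportDim, hsupp]

theorem exists_finset_maximalIdeal_pow_le_span (B : Type*) [CommRing B] [IsLocalRing B]
    [IsNoetherianRing B] :
    ∃ s : Finset B, (s : Set B) ⊆ maximalIdeal B ∧ (s.card : WithBot ℕ∞) = ringKrullDim B ∧
      ∃ k, maximalIdeal B ^ k ≤ Ideal.span s := by
  obtain ⟨s, hs, hcard⟩ := (maximalIdeal B).exists_finset_card_eq_height_of_isNoetherianRing
  refine ⟨s, Ideal.span_le.mp hs.1.2, ?_, ?_⟩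
  · rw [← maximalIdeal_height_eq_ringKrullDim, ← hcard, WithBot.coe_natCast]
  · refine Ideal.exists_pow_le_of_le_radical_of_fg ?_ (IsNoetherian.noetherian _)
    rw [Ideal.radical_eq_sInf]
    exact le_sInf fun p ⟨hp, hp'⟩ => hs.2 ⟨hp', hp⟩ (le_maximalIdeal hp'.ne_top)

theorem exists_finset_maximalIdeal_pow_le_sup_span {I : Ideal B} (hI : I ≤ maximalIdeal B) :
    ∃ s : Finset B, (s : Set B) ⊆ maximalIdeal B ∧ (s.card : WithBot ℕ∞) = ringKrullDim (B ⧸ I) ∧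
      ∃ k, maximalIdeal B ^ k ≤ I ⊔ Ideal.span s := by
  classical
  have : Nontrivial (B ⧸ I) := Ideal.Quotient.nontrivial_iff.mpr
    fun h => (maximalIdeal.isMaximal B).ne_top (top_le_iff.mp (h ▸ hI))
  have : IsLocalRing (B ⧸ I) := .of_surjective' _ Ideal.Quotient.mk_surjective
  have hmax : (maximalIdeal B).map (Ideal.Quotient.mk I) = maximalIdeal (B ⧸ I) :=
    map_maximalIdeal_of_surjective _ Ideal.Quotient.mk_surjective
  obtain ⟨s, hs, hcard, k, hk⟩ := exists_finset_maximalIdeal_pow_le_span (B ⧸ I)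
  obtain ⟨t, ht, rfl⟩ : ∃ t : Finset B, t.card = s.card ∧ t.image (Ideal.Quotient.mk I) = s :=
    ⟨s.image Quotient.out, Finset.card_image_of_injective _ Quotient.out_injective, by
      simp [Finset.image_image, Function.comp_def]⟩
  refine ⟨t, fun b hb => ?_, by rw [ht, hcard], k, ?_⟩
  · have hmem : Ideal.Quotient.mk I b ∈ maximalIdeal (B ⧸ I) :=
      hs (Finset.mem_coe.mpr (Finset.mem_image_of_mem _ hb))
    rwa [← hmax, ← Ideal.mem_comap, Ideal.comap_map_mk hI] at hmem
  · rw [← Ideal.comap_map_mk (le_sup_left : I ≤ I ⊔ Ideal.span (t : Set B)),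
      ← Ideal.map_le_iff_le_comap, Ideal.map_pow, hmax, Ideal.map_sup, Ideal.map_quotient_self,
      bot_sup_eq, Ideal.map_span, ← Finset.coe_image]
    exact hk

end SystemOfParameters

theorem exists_mem_forall_notMem_minimalPrimes {B : Type*} [CommRing B] [IsNoetherianRing B]
    {P : Ideal B} [P.IsPrime] (hP : 1 ≤ P.height) {a : B} (ha : a ∉ P) :
    ∃ x ∈ P, ∀ p ∈ (Ideal.span {a}).minimalPrimes, x ∉ p := by
  by_contra! h
  have hfin := Ideal.finite_minimalPrimes_of_isNoetherianRing B (Ideal.span {a})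
  obtain ⟨p, hp, hPp⟩ := (P.subset_union_prime_finite hfin (f := id) 0 0
    fun p hp _ _ => hp.1.1).mp fun x hx => by
      obtain ⟨p, hp, hxp⟩ := h x hx
      exact Set.mem_biUnion hp hxp
  have := hp.1.1
  have hheight : p.height ≤ 1 := Ideal.height_le_one_of_isPrincipal_of_mem_minimalPrimes _ _ hp
  have hPp' : P = p := Ideal.eq_of_le_of_height_le P hPp (hheight.trans hP)
  exact ha (hPp' ▸ hp.1.2 (Ideal.mem_span_singleton_self _))

/-! ### Coefficient rings and height one primes -/

/-- A normal complete Noetherian local domain `R` of dimension `n` with a homomorphism `f` to a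
local ring `B` which is surjective on residue fields and for which `f` extends the maximal ideal of
`R` to `J`. When `J` contains a power of the maximal ideal, `B` is finite over `R`. -/
structure IsNormalCover {R B : Type*} [CommRing R] [CommRing B] [IsLocalRing B] (f : R →+* B)
    (J : Ideal B) (n : ℕ) : Prop where
  isDomain : IsDomain R
  isNoetherianRing : IsNoetherianRing R
  isLocalRing : IsLocalRing R
  isIntegrallyClosed : IsIntegrallyClosed R
  isPrecomplete : IsPrecomplete (maximalIdeal R) R
  ringKrullDim_eq : ringKrullDim R = n
  map_maximalIdeal : (maximalIdeal R).map f = J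
  exists_sub_mem : ∀ b, ∃ r, b - f r ∈ maximalIdeal B

namespace IsNormalCover

theorem exists_adjoin {R B : Type*} [CommRing R] [CommRing B] [IsLocalRing B]
    [IsAdicComplete (maximalIdeal B) B] {f : R →+* B} {J : Ideal B} {n : ℕ}
    (hf : IsNormalCover f J n) {x : B} (hx : x ∈ maximalIdeal B) :
    ∃ F : PowerSeries R →+* B, IsNormalCover F (J ⊔ Ideal.span {x}) (n + 1) ∧
      F PowerSeries.X = x ∧ ∀ s, F (PowerSeries.C s) = f s := by
  obtain ⟨F, hFX, hFC⟩ := exists_powerSeries_ringHom_eval f hx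
  obtain ⟨_, _, _, _, _, hdim, hmap, hres⟩ := hf
  have hcomp : F.comp PowerSeries.C = f := RingHom.ext hFC
  refine ⟨F, ⟨inferInstance, inferInstance, inferInstance, isIntegrallyClosed_powerSeries R,
    ?_, ?_, ?_, fun b => ?_⟩, hFX, hFC⟩
  · rw [maximalIdeal_powerSeries]
    exact isPrecomplete_map_C_sup_span_X _
  · rw [ringKrullDim_powerSeries, hdim, Nat.cast_add, Nat.cast_one]
  · rw [maximalIdeal_powerSeries, Ideal.map_sup, Ideal.map_map, hcomp, hmap, Ideal.map_span,
      Set.image_singleton, hFX]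
  · obtain ⟨r, hr⟩ := hres b
    exact ⟨PowerSeries.C r, by rwa [hFC]⟩

theorem exists_adjoin_finset.{u} {R B : Type u} [CommRing R] [CommRing B] [IsLocalRing B]
    [IsAdicComplete (maximalIdeal B) B] {f : R →+* B} {J : Ideal B} {n : ℕ}
    (hf : IsNormalCover f J n) (s : Finset B) (hs : (s : Set B) ⊆ maximalIdeal B) :
    ∃ (R' : Type u) (_ : CommRing R') (F : R' →+* B) (g : R →+* R'),
      IsNormalCover F (J ⊔ Ideal.span s) (n + s.card) ∧ F.comp g = f ∧
      ∀ π, Prime π → Prime (g π) := by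
  classical
  induction s using Finset.induction_on with
  | empty => exact ⟨R, _, f, RingHom.id R, by simpa using hf, rfl, fun _ h => h⟩
  | insert x s hxs ih =>
    rw [Finset.coe_insert, Set.insert_subset_iff] at hs
    obtain ⟨R', _, F, g, hF, hFg, hg⟩ := ih hs.2
    obtain ⟨F', hF', -, hC⟩ := hF.exists_adjoin hs.1
    have := hF.isDomain
    refine ⟨PowerSeries R', inferInstance, F', PowerSeries.C.comp g, ?_, ?_,
      fun π hπ => prime_powerSeries_C (hg π hπ)⟩
    · rwa [Finset.card_insert_of_notMem hxs, ← add_assoc, Finset.coe_insert,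
        Ideal.span_insert, sup_comm (Ideal.span {x}), ← sup_assoc]
    · rw [← RingHom.comp_assoc, (RingHom.ext hC : F'.comp PowerSeries.C = F), hFg]

theorem finite {R B : Type*} [CommRing R] [CommRing B] [IsLocalRing B] [IsNoetherianRing B]
    {f : R →+* B} {J : Ideal B} {n : ℕ} (hf : IsNormalCover f J n) (hJ : J ≤ maximalIdeal B)
    {k : ℕ} (hk : maximalIdeal B ^ k ≤ J) : f.Finite := by
  obtain ⟨_, _, _, _, _, _, rfl, hres⟩ := hf
  algebraize [f]
  exact moduleFinite_of_maximalIdeal_pow_le_map hres hJ hk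

end IsNormalCover

theorem injective_of_isIntegral_of_ringKrullDim_le {R B : Type*} [CommRing R] [IsDomain R]
    [IsLocalRing R] [IsNoetherianRing R] [CommRing B] {f : R →+* B} (hf : f.IsIntegral)
    (hdim : ringKrullDim R ≤ ringKrullDim B) : Function.Injective f := by
  rw [injective_iff_map_eq_zero]
  intro a ha
  by_contra ha0
  let g : R ⧸ Ideal.span {a} →+* B := Ideal.Quotient.lift _ f
    ((Ideal.span_singleton_le_iff_mem (RingHom.ker f)).mpr ha)
  have hg : g.IsIntegral := RingHom.IsIntegral.tower_top (Ideal.Quotient.mk _) g hf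
  algebraize [g]
  have hquot := ringKrullDim_quotient_succ_le_of_nonZeroDivisor (mem_nonZeroDivisors_of_ne_zero ha0)
  have hle : ringKrullDim R + 1 ≤ ringKrullDim R :=
    (add_le_add_left (hdim.trans (ringKrullDim_le_of_isIntegral _ B)) 1).trans hquot
  obtain ⟨n, hn⟩ := exists_ringKrullDim_eq_natCast R
  rw [hn] at hle
  norm_cast at hle
  omega

/-- A coefficient ring of a local ring: a field, or a complete discrete valuation ring whose
uniformizer `ϖ` maps to a nonzero element of the maximal ideal. -/
def HasCoefficientRing.{u} (B : Type u) [CommRing B] [IsLocalRing B] : Prop :=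
  ∃ (Λ : Type u) (_ : CommRing Λ) (f : Λ →+* B), IsNormalCover f ⊥ 0 ∨
    ∃ ϖ : Λ, Prime ϖ ∧ f ϖ ≠ 0 ∧ f ϖ ∈ maximalIdeal B ∧ IsNormalCover f (Ideal.span {f ϖ}) 1

section HeightOne

universe u

variable {B : Type u} [CommRing B] [IsLocalRing B] [IsDomain B] [IsNoetherianRing B]
  {P : Ideal B} [P.IsPrime]

theorem IsNormalCover.ringKrullDim_le_of_maximalIdeal_pow_le {R : Type*} [CommRing R] {f : R →+* B}
    {J : Ideal B} {n : ℕ} (hf : IsNormalCover f J n) (hn : ringKrullDim B = n)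
    (hJ : J ≤ maximalIdeal B) {k : ℕ} (hk : maximalIdeal B ^ k ≤ J) (hP : P.height ≤ 1) {π : R}
    (hπ : Prime π) (hπP : f π ∈ P) : ringKrullDim B ≤ ringKrullDim (B ⧸ P) + 1 := by
  have hfin := hf.finite hJ hk
  obtain ⟨_, _, _, _, _, hdim, -, -⟩ := hf
  have hinj := injective_of_isIntegral_of_ringKrullDim_le hfin.to_isIntegral (hdim.trans hn.symm).le
  algebraize [f]
  have : FaithfulSMul R B := (faithfulSMul_iff_algebraMap_injective R B).mpr hinj
  exact ringKrullDim_le_quotient_add_one_of_prime_mem hP hπ hπP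

variable [IsAdicComplete (maximalIdeal B) B]

theorem IsNormalCover.ringKrullDim_le_of_prime_mem {R : Type u} [CommRing R] {f : R →+* B}
    {J : Ideal B} {n : ℕ} (hf : IsNormalCover f J n) (hJ : J ≤ maximalIdeal B)
    (hn : ringKrullDim (B ⧸ J) + n = ringKrullDim B) (hP : P.height ≤ 1) {π : R} (hπ : Prime π)
    (hπP : f π ∈ P) : ringKrullDim B ≤ ringKrullDim (B ⧸ P) + 1 := by
  obtain ⟨s, hs, hcard, k, hk⟩ := exists_finset_maximalIdeal_pow_le_sup_span hJ
  obtain ⟨R', _, F, g, hF, rfl, hg⟩ := hf.exists_adjoin_finset s hs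
  refine hF.ringKrullDim_le_of_maximalIdeal_pow_le ?_ (sup_le hJ (Ideal.span_le.mpr hs)) hk hP
    (hg π hπ) hπP
  rw [← hn, ← hcard, ← Nat.cast_add, add_comm]

theorem HasCoefficientRing.ringKrullDim_le_of_height_eq_one (hB : HasCoefficientRing B)
    (hP : P.height = 1) : ringKrullDim B ≤ ringKrullDim (B ⧸ P) + 1 := by
  have hPm : P ≤ maximalIdeal B := le_maximalIdeal ‹P.IsPrime›.ne_top
  have hspan : ∀ x ∈ maximalIdeal B, Ideal.span {x} ≤ maximalIdeal B := fun x hx =>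
    (Ideal.span_singleton_le_iff_mem _).mpr hx
  have hquot : ∀ x ≠ 0, x ∈ maximalIdeal B →
      ringKrullDim (B ⧸ Ideal.span {x}) + 1 = ringKrullDim B := fun x hx =>
    ringKrullDim_quotient_span_singleton_succ_eq_ringKrullDim_of_mem_nonZeroDivisors
      (mem_nonZeroDivisors_of_ne_zero hx)
  obtain ⟨Λ, _, f, hf | ⟨ϖ, hϖ, hϖ0, hϖm, hf⟩⟩ := hB
  · obtain ⟨x, hxP, hx0⟩ := P.ne_bot_iff.mp (Ideal.ne_bot_of_height_eq_one hP)
    obtain ⟨F, hF, hFX, -⟩ := hf.exists_adjoin (hPm hxP)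
    have := hf.isDomain
    rw [bot_sup_eq, zero_add] at hF
    exact hF.ringKrullDim_le_of_prime_mem (hspan x (hPm hxP)) (hquot x hx0 (hPm hxP)) hP.le
      PowerSeries.X_prime (hFX ▸ hxP)
  by_cases hϖP : f ϖ ∈ P
  · exact hf.ringKrullDim_le_of_prime_mem (hspan _ hϖm) (hquot _ hϖ0 hϖm) hP.le hϖ hϖP
  · obtain ⟨x, hxP, hx⟩ := exists_mem_forall_notMem_minimalPrimes hP.ge hϖP
    obtain ⟨F, hF, hFX, -⟩ := hf.exists_adjoin (hPm hxP)
    have := hf.isDomain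
    refine hF.ringKrullDim_le_of_prime_mem (sup_le (hspan _ hϖm) (hspan x (hPm hxP))) ?_ hP.le
      PowerSeries.X_prime (hFX ▸ hxP)
    rw [← hquot _ hϖ0 hϖm, ← ringKrullDim_quotient_sup_span_singleton_add_one hx (hPm hxP),
      add_assoc, Nat.cast_add, Nat.cast_one]

end HeightOne

theorem height_add_one_le_height_comap_mk {B : Type*} [CommRing B] [IsDomain B]
    [IsNoetherianRing B] {q : Ideal B} (hq : q ≠ ⊥) (P : Ideal (B ⧸ q)) [P.IsPrime] :
    P.height + 1 ≤ (P.comap (Ideal.Quotient.mk q)).height := by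
  obtain ⟨l, hl, hlen⟩ := P.exists_ltSeries_length_eq_height
  have hmono : StrictMono (PrimeSpectrum.comap (Ideal.Quotient.mk q)) := fun p p' h =>
    lt_of_le_of_ne (Ideal.comap_mono h.le) fun he => h.ne
      (PrimeSpectrum.comap_injective_of_surjective _ Ideal.Quotient.mk_surjective he)
  have hbot : ⊥ < (l.map _ hmono).head := by
    refine bot_lt_iff_ne_bot.mpr fun h => hq (le_bot_iff.mp ?_)
    have hle : RingHom.ker (Ideal.Quotient.mk q) ≤ (l.map _ hmono).head.asIdeal :=
      Ideal.comap_mono bot_le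
    rwa [Ideal.mk_ker, h] at hle
  have hlast := Order.length_le_height_last (p := (l.map _ hmono).cons ⊥ hbot)
  rw [RelSeries.last_cons, LTSeries.last_map, hl, ← PrimeSpectrum.height_eq_orderHeight] at hlast
  simpa [hlen] using hlast

/-! ### Coefficient fields in residue characteristic zero -/

theorem isNormalCover_of_isField {K B : Type*} [CommRing K] (hK : IsField K) [CommRing B]
    [IsLocalRing B] (f : K →+* B) (hf : ∀ b, ∃ r, b - f r ∈ maximalIdeal B) :
    IsNormalCover f ⊥ 0 := by
  let := hK.toField
  have hbot : maximalIdeal K = ⊥ := maximalIdeal_eq_bot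
  refine ⟨inferInstance, inferInstance, inferInstance, inferInstance, ?_, ?_, ?_, hf⟩
  · rw [hbot]; infer_instance
  · rw [ringKrullDim_eq_zero_of_isField hK, Nat.cast_zero]
  · rw [hbot, Ideal.map_bot]

theorem hasCoefficientRing_of_charZero (B : Type*) [CommRing B] [IsLocalRing B]
    [IsAdicComplete (maximalIdeal B) B] [CharZero (ResidueField B)] : HasCoefficientRing B := by
  have hunit : ∀ n : ℤ, n ≠ 0 → IsUnit (n : B) := fun n hn => by
    rwa [← residue_ne_zero_iff_isUnit, map_intCast, Int.cast_ne_zero]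
  let : Algebra ℚ B := (IsLocalization.lift (M := nonZeroDivisors ℤ) (S := ℚ)
    (g := Int.castRingHom B) fun n => hunit n (nonZeroDivisors.ne_zero n.2)).toAlgebra
  obtain ⟨s, hs⟩ := exists_isTranscendenceBasis ℚ (ResidueField B)
  have : Algebra.IsAlgebraic (IntermediateField.adjoin ℚ (Set.range ((↑) : s → ResidueField B)))
    (ResidueField B) := hs.isAlgebraic_field
  have : Algebra.FormallySmooth ℚ (ResidueField B) := .of_algebraicIndependent_of_isSeparable hs.1
  obtain ⟨g, hg⟩ := Algebra.FormallySmooth.exists_mkₐ_comp_eq_of_isAdicComplete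
    (I := maximalIdeal B) (A := ResidueField B)
    (RingHom.toRatAlgHom (S := B ⧸ maximalIdeal B) (RingHom.id (ResidueField B)))
  refine ⟨ResidueField B, inferInstance, g.toRingHom,
    .inl (isNormalCover_of_isField (Field.toIsField _) _ fun b => ⟨residue B b, ?_⟩)⟩
  rw [← residue_eq_zero_iff, map_sub, sub_eq_zero]
  exact (DFunLike.congr_fun hg (residue B b)).symm

/-! ### `p`-bases -/

section PIndependence

open MvPolynomial

theorem exists_eq_sum_mul_X_pow {σ R : Type*} [CommSemiring R] (f : MvPolynomial σ R) (a : σ)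
    {n : ℕ} (hf : ∀ e ∈ f.support, e a < n) :
    ∃ F : ℕ → MvPolynomial σ R, f = ∑ j ∈ Finset.range n, F j * X a ^ j ∧
      ∀ j, ∀ e' ∈ (F j).support, ∃ e ∈ f.support, e' = e.erase a := by
  classical
  refine ⟨fun j => ∑ e ∈ f.support with e a = j, monomial (e.erase a) (coeff e f), ?_,
    fun j e' he' => ?_⟩
  · conv_lhs => rw [f.as_sum]
    rw [← Finset.sum_fiberwise_of_maps_to (g := fun e => e a) (t := Finset.range n)
      (fun e he => Finset.mem_range.mpr (hf e he))]
    refine Finset.sum_congr rfl fun j _ => ?_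
    rw [Finset.sum_mul]
    refine Finset.sum_congr rfl fun e he => ?_
    rw [X_pow_eq_monomial, monomial_mul, mul_one, ← (Finset.mem_filter.mp he).2,
      Finsupp.erase_add_single]
  · obtain ⟨e, he, he''⟩ := Finset.mem_biUnion.mp (support_sum he')
    exact ⟨e, (Finset.mem_filter.mp he).1,
      by simpa using Finset.mem_of_subset support_monomial_subset he''⟩

variable {k : Type*} [Field k] {p : ℕ} [hp : Fact p.Prime] [CharP k p]

theorem linearIndependent_pow_of_notMem {F : Type*} [Field F] [Algebra F k] {a : k}
    (hap : a ^ p ∈ (algebraMap F k).range) (ha : a ∉ (algebraMap F k).range) :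
    LinearIndependent F fun j : Fin p => a ^ (j : ℕ) := by
  obtain ⟨c, hc⟩ := hap
  have hirr : Irreducible (Polynomial.X ^ p - Polynomial.C c) := by
    refine X_pow_sub_C_irreducible_of_prime hp.out fun b hb => ha ⟨b, frobenius_inj k p ?_⟩
    rw [frobenius_def, frobenius_def, ← map_pow, hb, hc]
  have hmin : minpoly F a = Polynomial.X ^ p - Polynomial.C c :=
    (minpoly.eq_of_irreducible_of_monic hirr (by simp [hc])
      (Polynomial.monic_X_pow_sub_C _ hp.out.ne_zero)).symm
  have hdeg : (minpoly F a).natDegree = p := by rw [hmin, Polynomial.natDegree_X_pow_sub_C]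
  have := linearIndependent_pow (K := F) a
  rwa [hdeg] at this

variable (p) in
/-- `p`-independence of a subset `T` of a field of characteristic `p`: the monomials in the elements
of `T` with exponents less than `p` are linearly independent over the subfield of `p`-th powers. The
coefficients of a polynomial `f` are replaced by their `p`-th powers when `f` is evaluated. -/
def IsPIndependent (T : Set k) : Prop :=
  ∀ f : MvPolynomial k k, (f.vars : Set k) ⊆ T → (∀ e ∈ f.support, ∀ i, e i < p) →
    eval₂Hom (frobenius k p) id f = 0 → f = 0

theorem isPIndependent_empty : IsPIndependent p (∅ : Set k) := by
  intro f hf _ hf0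
  have hC : f = C (coeff 0 f) := vars_eq_empty_iff_eq_C.mp (by simpa using hf)
  rw [hC] at hf0 ⊢
  have : frobenius k p (coeff 0 f) = 0 := by simpa using hf0
  rw [(map_eq_zero _).mp this, C_0]

variable (k p) in
theorem exists_maximal_isPIndependent : ∃ T : Set k, Maximal (IsPIndependent p) T := by
  refine zorn_subset {T | IsPIndependent p T} fun c hc hchain => ?_
  rcases c.eq_empty_or_nonempty with rfl | hne
  · exact ⟨∅, isPIndependent_empty, fun s hs => hs.elim⟩
  refine ⟨⋃₀ c, fun f hf => ?_, fun s hs => Set.subset_sUnion_of_mem hs⟩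
  obtain ⟨s, hs, hfs⟩ := DirectedOn.exists_mem_subset_of_finset_subset_biUnion hne
    (f := id) (s := f.vars) hchain.directedOn (by simpa [Set.sUnion_eq_biUnion] using hf)
  exact hc hs f hfs

theorem IsPIndependent.insert {T : Set k} (hT : IsPIndependent p T)
    {L : Subfield k} (hL : ∀ x : k, x ^ p ∈ L) (hTL : T ⊆ L) {a : k} (ha : a ∉ L) :
    IsPIndependent p (insert a T) := by
  classical
  intro f hfv hfp hf0
  obtain ⟨F, hF, hFsupp⟩ := exists_eq_sum_mul_X_pow f a fun e he => hfp e he a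
  have hFv (j : ℕ) : ((F j).vars : Set k) ⊆ T := by
    intro i hi
    obtain ⟨e', he', hi'⟩ := (mem_vars_iff_mem_support (i := i)).mp hi
    obtain ⟨e, he, rfl⟩ := hFsupp j e' he'
    rw [Finsupp.support_erase, Finset.mem_erase] at hi'
    exact (hfv ((mem_vars_iff_mem_support (i := i)).mpr ⟨e, he, hi'.2⟩)).resolve_left hi'.1
  have hFp (j : ℕ) : ∀ e' ∈ (F j).support, ∀ i, e' i < p := by
    intro e' he' i
    obtain ⟨e, he, rfl⟩ := hFsupp j e' he'
    rw [Finsupp.erase_apply]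
    split_ifs
    exacts [hp.out.pos, hfp e he i]
  have hFL (j : ℕ) : eval₂Hom (frobenius k p) id (F j) ∈ L := by
    rw [coe_eval₂Hom, eval₂_eq]
    refine sum_mem fun e he => mul_mem (hL _) (prod_mem fun i hi => pow_mem (hTL (hFv j ?_)) _)
    exact (mem_vars_iff_mem_support (i := i)).mpr ⟨e, he, hi⟩
  have hlin : LinearIndependent L fun j : Fin p => a ^ (j : ℕ) :=
    linearIndependent_pow_of_notMem ⟨⟨a ^ p, hL a⟩, rfl⟩ (by rintro ⟨x, rfl⟩; exact ha x.2)
  have hrel : ∑ j : Fin p, (⟨_, hFL j⟩ : L) • a ^ (j : ℕ) = 0 := by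
    rw [hF, Finset.sum_range] at hf0
    simpa [Subfield.smul_def] using hf0
  rw [hF]
  refine Finset.sum_eq_zero fun j hj => ?_
  have hcoeff := Fintype.linearIndependent_iff.mp hlin _ hrel ⟨j, Finset.mem_range.mp hj⟩
  rw [hT (F j) (hFv j) (hFp j) (congrArg Subtype.val hcoeff), zero_mul]

theorem adjoin_eq_top_of_maximal_isPIndependent {T : Set k} (hT : Maximal (IsPIndependent p) T) :
    Algebra.adjoin (frobenius k p).fieldRange T = ⊤ := by
  have hpow (x : k) : x ^ p = algebraMap (frobenius k p).fieldRange k ⟨x ^ p, x, rfl⟩ := rfl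
  have halg (x : k) : IsAlgebraic (frobenius k p).fieldRange x :=
    (IsIntegral.of_pow hp.out.pos (hpow x ▸ isIntegral_algebraMap)).isAlgebraic
  rw [← IntermediateField.adjoin_toSubalgebra_of_isAlgebraic fun x _ => halg x,
    ← IntermediateField.top_toSubalgebra]
  refine congrArg _ (eq_top_iff.mpr fun a _ => ?_)
  set L := IntermediateField.adjoin (frobenius k p).fieldRange T
  have hTL : T ⊆ L := IntermediateField.subset_adjoin _ T
  by_contra ha
  have hins : IsPIndependent p (insert a T) :=
    hT.prop.insert (L := L.toSubfield) (fun x => hpow x ▸ L.algebraMap_mem _) hTL ha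
  exact ha (hTL (hT.le_of_ge hins (Set.subset_insert a T) (Set.mem_insert a T)))

/-- A `p`-basis of a field of characteristic `p`: the monomials in `b` with exponents less than `p`
form a basis over the subfield of `p`-th powers. As in `IsPIndependent`, the coefficients of a
polynomial are replaced by their `p`-th powers when it is evaluated. -/
structure IsPBasis {ι k : Type*} [Field k] (p : ℕ) [ExpChar k p] (b : ι → k) : Prop where
  surjective : Function.Surjective (eval₂Hom (frobenius k p) b)
  eq_zero : ∀ f : MvPolynomial ι k, (∀ e ∈ f.support, ∀ i, e i < p) →
    eval₂Hom (frobenius k p) b f = 0 → f = 0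

theorem IsPIndependent.eq_zero {T : Set k} (hT : IsPIndependent p T) (f : MvPolynomial T k)
    (hf : ∀ e ∈ f.support, ∀ i, e i < p) (hf0 : eval₂Hom (frobenius k p) ((↑) : T → k) f = 0) :
    f = 0 := by
  classical
  apply rename_injective _ Subtype.val_injective
  rw [map_zero]
  refine hT _ (fun i hi => ?_) (fun e he i => ?_) ?_
  · obtain ⟨j, -, rfl⟩ := Finset.mem_image.mp (vars_rename _ f hi)
    exact j.2
  · rw [support_rename_of_injective Subtype.val_injective] at he
    obtain ⟨e', he', rfl⟩ := Finset.mem_image.mp he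
    by_cases hi : i ∈ Set.range (Subtype.val : T → k)
    · obtain ⟨j, rfl⟩ := hi
      rw [Finsupp.mapDomain_apply Subtype.val_injective]
      exact hf e' he' j
    · rw [Finsupp.mapDomain_of_notMem_range _ _ hi]
      exact hp.out.pos
  · rw [coe_eval₂Hom, eval₂_rename]
    exact hf0

variable (k p) in
theorem exists_isPBasis : ∃ T : Set k, IsPBasis p ((↑) : T → k) := by
  obtain ⟨T, hT⟩ := exists_maximal_isPIndependent k p
  refine ⟨T, fun a => ?_, hT.prop.eq_zero⟩
  have ha : a ∈ Algebra.adjoin (frobenius k p).fieldRange T :=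
    adjoin_eq_top_of_maximal_isPIndependent hT ▸ Algebra.mem_top
  rw [← RingHom.mem_range]
  induction ha using Algebra.adjoin_induction with
  | mem x hx => exact ⟨X ⟨x, hx⟩, by simp⟩
  | algebraMap r =>
    obtain ⟨_, c, rfl⟩ := r
    exact ⟨C c, by simp; rfl⟩
  | add x y _ _ hx hy => exact add_mem hx hy
  | mul x y _ _ hx hy => exact mul_mem hx hy

namespace IsPBasis

variable {ι : Type*} {b : ι → k}

theorem surjective_iterateFrobenius (hb : IsPBasis p b) (n : ℕ) :
    Function.Surjective (eval₂Hom (iterateFrobenius k p n) b) := by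
  rw [← RingHom.range_eq_top]
  induction n with
  | zero =>
    rw [RingHom.range_eq_top]
    exact fun a => ⟨C a, by simp⟩
  | succ n ih =>
    rw [← top_le_iff, ← ih]
    have hX (i : ι) : b i ∈ (eval₂Hom (iterateFrobenius k p (n + 1)) b).range := ⟨X i, by simp⟩
    have hC (c : k) : c ^ p ^ (n + 1) ∈ (eval₂Hom (iterateFrobenius k p (n + 1)) b).range :=
      ⟨C c, by simp [iterateFrobenius_def]⟩
    rintro _ ⟨f, rfl⟩
    rw [coe_eval₂Hom, eval₂_eq]
    refine sum_mem fun e _ => mul_mem ?_ (prod_mem fun i _ => pow_mem (hX i) _)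
    obtain ⟨g, hg⟩ := hb.surjective (coeff e f)
    rw [← hg, coe_eval₂Hom, eval₂_eq, map_sum]
    refine sum_mem fun e' _ => ?_
    rw [map_mul, map_prod]
    refine mul_mem ?_ (prod_mem fun i _ => ?_)
    · rw [iterateFrobenius_def, frobenius_def, ← pow_mul, ← pow_succ']
      exact hC _
    · rw [map_pow, iterateFrobenius_def]
      exact pow_mem (pow_mem (hX i) _) _

end IsPBasis

theorem mem_span_X_sub_C_of_eval_eq_zero {σ R : Type*} [CommRing R] (b : σ → R)
    (f : MvPolynomial σ R) (hf : eval b f = 0) :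
    f ∈ Ideal.span (Set.range fun i => X i - C (b i) : Set (MvPolynomial σ R)) := by
  set I := Ideal.span (Set.range fun i => X i - C (b i) : Set (MvPolynomial σ R))
  have hmk : Ideal.Quotient.mk I = ((Ideal.Quotient.mk I).comp C).comp (eval b) := by
    refine ringHom_ext (fun r => by simp) fun i => ?_
    have : X i - C (b i) ∈ I := Ideal.subset_span ⟨i, rfl⟩
    simpa [sub_eq_zero] using Ideal.Quotient.eq_zero_iff_mem.mpr this
  rw [← Ideal.Quotient.eq_zero_iff_mem, hmk, RingHom.comp_apply, hf, map_zero]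

theorem exists_eq_sum_monomial_mul_expand {σ R : Type*} [CommSemiring R] (f : MvPolynomial σ R)
    {n : ℕ} (hn : 0 < n) : ∃ (s : Finset (σ →₀ ℕ)) (G : (σ →₀ ℕ) → MvPolynomial σ R),
      (∀ e ∈ s, ∀ i, e i < n) ∧ f = ∑ e ∈ s, monomial e 1 * expand n (G e) := by
  classical
  let q : (σ →₀ ℕ) → (σ →₀ ℕ) := fun e => e.mapRange (· / n) (Nat.zero_div n)
  let r : (σ →₀ ℕ) → (σ →₀ ℕ) := fun e => e.mapRange (· % n) (Nat.zero_mod n)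
  have hqr (e : σ →₀ ℕ) : r e + n • q e = e := by
    ext i
    simp [q, r, Nat.mod_add_div]
  refine ⟨f.support.image r, fun e' => ∑ e ∈ f.support with r e = e', monomial (q e) (coeff e f),
    fun e he i => ?_, ?_⟩
  · obtain ⟨e, -, rfl⟩ := Finset.mem_image.mp he
    exact Nat.mod_lt _ hn
  · conv_lhs => rw [f.as_sum]
    rw [← Finset.sum_fiberwise_of_maps_to (g := r) (t := f.support.image r)
      (fun e he => Finset.mem_image_of_mem r he)]
    refine Finset.sum_congr rfl fun e' _ => ?_
    rw [map_sum, Finset.mul_sum]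
    refine Finset.sum_congr rfl fun e he => ?_
    rw [expand_monomial, monomial_mul, one_mul, ← (Finset.mem_filter.mp he).2, hqr]

theorem eval₂Hom_iterateFrobenius_succ_expand {ι : Type*} (b : ι → k) (n : ℕ)
    (g : MvPolynomial ι k) : eval₂Hom (iterateFrobenius k p (n + 1)) b (expand p g) =
      eval₂Hom (iterateFrobenius k p n) b g ^ p := by
  have : (eval₂Hom (iterateFrobenius k p (n + 1)) b).comp (expand p : _ →ₐ[k] _).toRingHom =
      (frobenius k p).comp (eval₂Hom (iterateFrobenius k p n) b) := by
    refine ringHom_ext (fun c => ?_) fun i => by simp [frobenius_def]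
    simp [iterateFrobenius_def, frobenius_def, pow_succ, pow_mul]
  exact RingHom.congr_fun this g

theorem IsPBasis.eval₂Hom_eq_zero_of_sum_eq_zero {ι : Type*} {b : ι → k} (hb : IsPBasis p b)
    {n : ℕ} {s : Finset (ι →₀ ℕ)} (hs : ∀ e ∈ s, ∀ i, e i < p)
    {G : (ι →₀ ℕ) → MvPolynomial ι k} (h : eval₂Hom (iterateFrobenius k p (n + 1)) b
      (∑ e ∈ s, monomial e 1 * expand p (G e)) = 0) {e : ι →₀ ℕ} (he : e ∈ s) :
    eval₂Hom (iterateFrobenius k p n) b (G e) = 0 := by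
  classical
  have hsum : ∑ e ∈ s, monomial e (eval₂Hom (iterateFrobenius k p n) b (G e)) = 0 := by
    refine hb.eq_zero _ (fun e he i => ?_) ?_
    · obtain ⟨e', he', he''⟩ := Finset.mem_biUnion.mp (support_sum he)
      obtain rfl : e = e' := by simpa using Finset.mem_of_subset support_monomial_subset he''
      exact hs e he' i
    · rw [map_sum] at h ⊢
      rw [← h]
      refine Finset.sum_congr rfl fun e _ => ?_
      rw [map_mul, eval₂Hom_iterateFrobenius_succ_expand]
      simp [eval₂_monomial, frobenius_def, mul_comm]
  have hcoeff := congrArg (coeff e) hsum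
  rw [coeff_sum, coeff_zero, Finset.sum_eq_single_of_mem e he fun e' _ hne => by
    rw [coeff_monomial, if_neg hne]] at hcoeff
  simpa using hcoeff

theorem IsPBasis.mem_span_of_eval₂_eq_zero {ι : Type*} {b : ι → k} (hb : IsPBasis p b) (n : ℕ)
    (f : MvPolynomial ι k) (hf : eval₂Hom (iterateFrobenius k p n) b f = 0) :
    f ∈ Ideal.span (Set.range fun i => X i ^ p ^ n - C (b i) : Set (MvPolynomial ι k)) := by
  induction n generalizing f with
  | zero =>
    simp only [pow_zero, pow_one]
    refine mem_span_X_sub_C_of_eval_eq_zero b f ?_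
    rwa [iterateFrobenius_zero] at hf
  | succ n ih =>
    obtain ⟨s, G, hs, rfl⟩ := exists_eq_sum_monomial_mul_expand f hp.out.pos
    refine sum_mem fun e he => Ideal.mul_mem_left _ _ ?_
    have hmem := Ideal.mem_map_of_mem (expand p : MvPolynomial ι k →ₐ[k] _).toRingHom
      (ih (G e) (hb.eval₂Hom_eq_zero_of_sum_eq_zero hs hf he))
    refine Ideal.map_le_iff_le_comap.mpr (Ideal.span_le.mpr ?_) hmem
    rintro _ ⟨i, rfl⟩
    exact Ideal.subset_span ⟨i, by simp [pow_succ', pow_mul]⟩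

end PIndependence

/-! ### Coefficient rings in positive residue characteristic -/

section GhostApproximation

open MvPolynomial WittVector

theorem ghostComponent_eq_sum {B : Type*} [CommRing B] {p : ℕ} [Fact p.Prime] (n : ℕ)
    (x : WittVector p B) :
    ghostComponent n x = ∑ i ∈ Finset.range (n + 1), (p : B) ^ i * x.coeff i ^ p ^ (n - i) := by
  rw [ghostComponent_apply, aeval_wittPolynomial]

theorem natCast_mem_maximalIdeal {B : Type*} [CommRing B] [IsLocalRing B] {p : ℕ}
    [CharP (ResidueField B) p] : (p : B) ∈ maximalIdeal B := by
  rw [← residue_eq_zero_iff, map_natCast, CharP.cast_eq_zero]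

theorem exists_ghostComponent_sub_mem {B : Type*} [CommRing B] {p : ℕ} [hp : Fact p.Prime]
    {I : Ideal B} (n : ℕ) {x : WittVector p B} (hx : x.coeff 0 ∈ I) :
    ∃ y : WittVector p B, ghostComponent (n + 1) x - p * ghostComponent n y ∈ I ^ (n + 2) := by
  refine ⟨WittVector.mk p fun i => x.coeff (i + 1), ?_⟩
  have hsub : ghostComponent (n + 1) x - p * ghostComponent n (.mk p fun i => x.coeff (i + 1)) =
      x.coeff 0 ^ p ^ (n + 1) := by
    simp only [ghostComponent_eq_sum, Finset.sum_range_succ' _ (n + 1), Finset.mul_sum, coeff_mk,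
      Nat.add_sub_add_right, pow_succ' (p : B), mul_assoc, pow_zero, one_mul, Nat.sub_zero,
      add_sub_cancel_left]
  rw [hsub]
  exact Ideal.pow_le_pow_right (Nat.lt_pow_self hp.out.one_lt) (Ideal.pow_mem_pow hx _)

variable {B ι : Type*} [CommRing B] [IsLocalRing B] {p : ℕ} [hp : Fact p.Prime]

theorem residue_ghostComponent [CharP (ResidueField B) p] (n : ℕ) (x : WittVector p B) :
    residue B (ghostComponent n x) = residue B (x.coeff 0) ^ p ^ n := by
  rw [ghostComponent_eq_sum, Finset.sum_range_succ']
  simp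

/-- The homomorphism to `B` from polynomials over the Witt vectors of `B`, given by the `n`-th
ghost component on the coefficients and by `c` on the variables. -/
noncomputable def ghostEval (p : ℕ) [Fact p.Prime] (c : ι → B) (n : ℕ) :
    MvPolynomial ι (WittVector p B) →+* B :=
  eval₂Hom (ghostComponent n) c

/-- The elements of `B` congruent modulo `𝔪 ^ (n + 1)` to an element of the range of
`ghostEval`. -/
noncomputable def ghostApprox (p : ℕ) [Fact p.Prime] (c : ι → B) (n : ℕ) : Subring B :=
  ((Ideal.Quotient.mk (maximalIdeal B ^ (n + 1))).comp (ghostEval p c n)).range.comap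
    (Ideal.Quotient.mk (maximalIdeal B ^ (n + 1)))

/-- The coefficient ring attached to a lift `c` of a `p`-basis of the residue field. If `B` is a
complete Noetherian local domain, this is a field or a discrete valuation ring with uniformizer `p`,
and it maps onto the residue field. -/
noncomputable def coefficientSubring (p : ℕ) [Fact p.Prime] (c : ι → B) : Subring B :=
  ⨅ n, ghostApprox p c n

variable {c : ι → B}

theorem mem_ghostApprox {n : ℕ} {y : B} :
    y ∈ ghostApprox p c n ↔ ∃ f, y - ghostEval p c n f ∈ maximalIdeal B ^ (n + 1) := by
  simp only [ghostApprox, Subring.mem_comap, RingHom.mem_range, RingHom.comp_apply]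
  refine exists_congr fun f => ?_
  rw [eq_comm, Ideal.Quotient.eq]

theorem mem_coefficientSubring {y : B} :
    y ∈ coefficientSubring p c ↔ ∀ n, y ∈ ghostApprox p c n := by
  simp [coefficientSubring, Subring.mem_iInf]

theorem ghostEval_mem_ghostApprox (n : ℕ) (f : MvPolynomial ι (WittVector p B)) :
    ghostEval p c n f ∈ ghostApprox p c n :=
  mem_ghostApprox.mpr ⟨f, by simp⟩

theorem mem_ghostApprox_of_mem_pow {n : ℕ} {y : B} (hy : y ∈ maximalIdeal B ^ (n + 1)) :
    y ∈ ghostApprox p c n :=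
  mem_ghostApprox.mpr ⟨0, by simpa using hy⟩

theorem mem_ghostApprox_of_sub_mem {n : ℕ} {x y : B} (hx : x ∈ ghostApprox p c n)
    (hxy : y - x ∈ maximalIdeal B ^ (n + 1)) : y ∈ ghostApprox p c n := by
  simpa using add_mem (mem_ghostApprox_of_mem_pow hxy) hx

theorem ghostApprox_antitone : Antitone (ghostApprox p c) := by
  refine antitone_nat_of_succ_le fun n y hy => ?_
  obtain ⟨f, hf⟩ := mem_ghostApprox.mp hy
  refine mem_ghostApprox.mpr ⟨map WittVector.frobenius f, ?_⟩
  have : ghostEval p c n (map WittVector.frobenius f) = ghostEval p c (n + 1) f := by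
    rw [ghostEval, coe_eval₂Hom, eval₂_map, ghostEval, coe_eval₂Hom]
    congr 1
    exact RingHom.ext fun x => ghostComponent_frobenius n x
  rw [this]
  exact Ideal.pow_le_pow_right (Nat.le_succ _) hf

variable [CharP (ResidueField B) p]

theorem exists_ghostComponent_mem_ghostApprox (hc : IsPBasis p fun i => residue B (c i))
    {j n : ℕ} (hj : j ≤ n) (x : WittVector p B) :
    ∃ w : WittVector p B, ghostComponent j w ∈ ghostApprox p c n ∧ x.coeff 0 - w.coeff 0 ∈
      maximalIdeal B := by
  obtain ⟨f, hf⟩ := hc.surjective_iterateFrobenius (n - j) (residue B (x.coeff 0))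
  choose σ hσ using residue_surjective (R := B)
  let w : WittVector p B := ∑ e ∈ f.support,
    teichmuller p (σ (coeff e f) ^ p ^ (n - j) * e.prod fun i m => c i ^ m)
  refine ⟨w, ?_, ?_⟩
  · have : ghostComponent j w = ghostEval p c n
        (∑ e ∈ f.support, monomial (p ^ j • e) (teichmuller p (σ (coeff e f)))) := by
      rw [map_sum, map_sum]
      refine Finset.sum_congr rfl fun e _ => ?_
      rw [ghostComponent_teichmuller, ghostEval, coe_eval₂Hom, eval₂_monomial,
        ghostComponent_teichmuller, mul_pow, ← pow_mul, ← pow_add, Nat.sub_add_cancel hj]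
      congr 1
      rw [Finsupp.prod_of_support_subset _ Finsupp.support_smul _ fun i _ => pow_zero _,
        Finsupp.prod, ← Finset.prod_pow]
      exact Finset.prod_congr rfl fun i _ => by
        rw [← pow_mul, mul_comm, Finsupp.smul_apply, smul_eq_mul]
    rw [this]
    exact ghostEval_mem_ghostApprox n _
  · rw [← residue_eq_zero_iff, map_sub, sub_eq_zero, ← hf, coe_eval₂Hom, eval₂_eq,
      ← WittVector.constantCoeff_apply, map_sum, map_sum]
    refine Finset.sum_congr rfl fun e _ => ?_
    rw [WittVector.constantCoeff_apply, teichmuller_coeff_zero, map_mul, map_pow, hσ, Finsupp.prod,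
      map_prod, iterateFrobenius_def]
    simp only [map_pow]

theorem exists_ghostComponent_sub_mem_ghostApprox (hc : IsPBasis p fun i => residue B (c i))
    {j n : ℕ} (hj : j ≤ n) (x : WittVector p B) :
    ∃ y ∈ ghostApprox p c n, ghostComponent j x - y ∈ maximalIdeal B ^ (j + 1) := by
  induction j generalizing x with
  | zero =>
    obtain ⟨w, hw, hxw⟩ := exists_ghostComponent_mem_ghostApprox hc hj x
    refine ⟨_, hw, ?_⟩
    simpa [ghostComponent_eq_sum] using hxw
  | succ j ih =>
    obtain ⟨w, hw, hxw⟩ := exists_ghostComponent_mem_ghostApprox hc hj x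
    obtain ⟨g, hg⟩ := exists_ghostComponent_sub_mem j (x := x - w) (by
      rwa [← constantCoeff_apply, map_sub])
    obtain ⟨y, hy, hgy⟩ := ih (by omega) g
    refine ⟨ghostComponent (j + 1) w + p * y, add_mem hw (mul_mem (natCast_mem _ p) hy), ?_⟩
    have hpgy := Ideal.mul_mem_mul (natCast_mem_maximalIdeal (B := B) (p := p)) hgy
    rw [← pow_succ'] at hpgy
    rw [map_sub] at hg
    convert add_mem hg hpgy using 1
    ring

theorem exists_mem_ghostApprox_succ_sub_mem (hc : IsPBasis p fun i => residue B (c i))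
    {n : ℕ} {y : B} (hy : y ∈ ghostApprox p c n) :
    ∃ z ∈ ghostApprox p c (n + 1), z - y ∈ maximalIdeal B ^ (n + 1) := by
  obtain ⟨f, hf⟩ := mem_ghostApprox.mp hy
  suffices ∃ z ∈ ghostApprox p c (n + 1), z - ghostEval p c n f ∈ maximalIdeal B ^ (n + 1) by
    obtain ⟨z, hz, hzf⟩ := this
    refine ⟨z, hz, ?_⟩
    convert sub_mem hzf hf using 1
    ring
  clear hf
  induction f using MvPolynomial.induction_on with
  | C x =>
    obtain ⟨z, hz, hxz⟩ := exists_ghostComponent_sub_mem_ghostApprox hc (Nat.le_succ n) x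
    exact ⟨z, hz, by rw [← neg_mem_iff]; simpa [ghostEval] using hxz⟩
  | add f g hf hg =>
    obtain ⟨z, hz, hz'⟩ := hf
    obtain ⟨w, hw, hw'⟩ := hg
    exact ⟨z + w, add_mem hz hw, by rw [map_add, add_sub_add_comm]; exact add_mem hz' hw'⟩
  | mul_X f i hf =>
    obtain ⟨z, hz, hz'⟩ := hf
    refine ⟨z * c i, mul_mem hz ?_, ?_⟩
    · simpa [ghostEval] using ghostEval_mem_ghostApprox (p := p) (c := c) (n + 1) (X i)
    · have : ghostEval p c n (X i) = c i := by simp [ghostEval]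
      rw [map_mul, this, ← sub_mul]
      exact Ideal.mul_mem_right _ _ hz'

theorem exists_ghostComponent_sub_natCast_mul_mem (hc : IsPBasis p fun i => residue B (c i)) {n : ℕ}
    {x : WittVector p B} (hx : x.coeff 0 ∈ maximalIdeal B) :
    ∃ z ∈ ghostApprox p c n, ghostComponent n x - p * z ∈ maximalIdeal B ^ (n + 1) := by
  cases n with
  | zero => exact ⟨0, zero_mem _, by simpa [ghostComponent_eq_sum] using hx⟩
  | succ n =>
    obtain ⟨y, hy⟩ := exists_ghostComponent_sub_mem n hx
    obtain ⟨z, hz, hyz⟩ := exists_ghostComponent_sub_mem_ghostApprox hc (Nat.le_succ n) y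
    refine ⟨z, hz, ?_⟩
    have hpyz := Ideal.mul_mem_mul (natCast_mem_maximalIdeal (B := B) (p := p)) hyz
    rw [← pow_succ'] at hpyz
    convert add_mem hy hpyz using 1
    ring

theorem residue_ghostEval (n : ℕ) (f : MvPolynomial ι (WittVector p B)) :
    residue B (ghostEval p c n f) =
      eval₂Hom (iterateFrobenius (ResidueField B) p n) (fun i => residue B (c i))
        (map ((residue B).comp WittVector.constantCoeff) f) := by
  have : (residue B).comp (ghostEval p c n) =
      (eval₂Hom (iterateFrobenius (ResidueField B) p n) fun i => residue B (c i)).comp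
        (map ((residue B).comp WittVector.constantCoeff)) := by
    refine ringHom_ext (fun x => ?_) fun i => by simp [ghostEval]
    simp [ghostEval, iterateFrobenius_def, residue_ghostComponent]
  exact RingHom.congr_fun this f

/- The reduction of `f` is a combination of the polynomials `X i ^ p ^ n - C (residue B (c i))`,
which lift to polynomials `X i ^ p ^ n - C (teichmuller p (c i))` killed by `ghostEval p c n`. -/
theorem exists_ghostEval_eq_of_mem_maximalIdeal (hc : IsPBasis p fun i => residue B (c i)) {n : ℕ}
    {f : MvPolynomial ι (WittVector p B)} (hf : ghostEval p c n f ∈ maximalIdeal B) :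
    ∃ g, (∀ e, (MvPolynomial.coeff e g).coeff 0 ∈ maximalIdeal B) ∧
      ghostEval p c n g = ghostEval p c n f := by
  let r : WittVector p B →+* ResidueField B := (residue B).comp WittVector.constantCoeff
  have hr : Function.Surjective r := residue_surjective.comp fun b => ⟨teichmuller p b, by simp⟩
  let J : Ideal (MvPolynomial ι (WittVector p B)) :=
    Ideal.span (Set.range fun i => X i ^ p ^ n - C (teichmuller p (c i)))
  have hJ : J.map (map r) = Ideal.span (Set.range fun i => X i ^ p ^ n - C (residue B (c i))) := by
    rw [Ideal.map_span, ← Set.range_comp]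
    congr 2
    ext1 i
    simp [r]
  have hJker : J ≤ RingHom.ker (ghostEval p c n) := by
    rw [Ideal.span_le]
    rintro _ ⟨i, rfl⟩
    simp [RingHom.mem_ker, ghostEval, ghostComponent_teichmuller]
  have hfJ : map r f ∈ J.map (map r) := by
    rw [hJ]
    refine hc.mem_span_of_eval₂_eq_zero n _ ?_
    rw [← residue_ghostEval, residue_eq_zero_iff]
    exact hf
  obtain ⟨g, hg, hgf⟩ := (Ideal.mem_map_iff_of_surjective (map r) (map_surjective r hr)).mp hfJ
  refine ⟨f - g, fun e => ?_, by rw [map_sub, RingHom.mem_ker.mp (hJker hg), sub_zero]⟩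
  have hcoeff : r (MvPolynomial.coeff e (f - g)) = 0 := by
    rw [← coeff_map, map_sub, hgf, sub_self, coeff_zero]
  exact (residue_eq_zero_iff _).mp hcoeff

theorem exists_mem_ghostApprox_sub_natCast_mul_mem (hc : IsPBasis p fun i => residue B (c i))
    {n : ℕ} {y : B} (hy : y ∈ ghostApprox p c n) (hym : y ∈ maximalIdeal B) :
    ∃ z ∈ ghostApprox p c n, y - p * z ∈ maximalIdeal B ^ (n + 1) := by
  obtain ⟨f, hf⟩ := mem_ghostApprox.mp hy
  obtain ⟨g, hg, hgf⟩ := exists_ghostEval_eq_of_mem_maximalIdeal hc (n := n) (f := f) <| by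
    simpa using sub_mem hym (Ideal.pow_le_self n.succ_ne_zero hf)
  choose z hz hgz using fun e => exists_ghostComponent_sub_natCast_mul_mem hc (n := n) (hg e)
  refine ⟨∑ e ∈ g.support, z e * ∏ i ∈ e.support, c i ^ e i,
    sum_mem fun e _ => mul_mem (hz e) (prod_mem fun i _ => pow_mem ?_ _), ?_⟩
  · simpa [ghostEval] using ghostEval_mem_ghostApprox (p := p) (c := c) n (X i)
  · have hsum : ghostEval p c n g - p * ∑ e ∈ g.support, z e * ∏ i ∈ e.support, c i ^ e i ∈
        maximalIdeal B ^ (n + 1) := by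
      rw [ghostEval, coe_eval₂Hom, eval₂_eq, Finset.mul_sum, ← Finset.sum_sub_distrib]
      refine sum_mem fun e _ => ?_
      rw [← mul_assoc, ← sub_mul]
      exact Ideal.mul_mem_right _ _ (hgz e)
    rw [← hgf] at hf
    simpa using add_mem hf hsum

end GhostApproximation

section NoetherianLocal

variable {B : Type*} [CommRing B] [IsLocalRing B] [IsNoetherianRing B]

theorem mem_of_forall_mem_sup_maximalIdeal_pow {I : Ideal B} {x : B}
    (h : ∀ n, x ∈ I ⊔ maximalIdeal B ^ n) : x ∈ I := by
  have : IsHausdorff (maximalIdeal B) (B ⧸ I) :=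
    .of_le_jacobson _ _ (maximalIdeal_le_jacobson _)
  rw [← Ideal.Quotient.eq_zero_iff_mem]
  refine this.haus' _ fun n => ?_
  rw [SModEq.zero]
  obtain ⟨a, ha, b, hb, rfl⟩ := Submodule.mem_sup.mp (h n)
  rw [map_add, Ideal.Quotient.eq_zero_iff_mem.mpr ha, zero_add, ← mul_one b]
  exact Submodule.smul_mem_smul hb (Submodule.mem_top (x := (1 : B ⧸ I)))

theorem isPrecomplete_of_le_maximalIdeal [IsPrecomplete (maximalIdeal B) B] {I : Ideal B}
    (hI : I ≤ maximalIdeal B) : IsPrecomplete I B := by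
  rw [isPrecomplete_iff_exists_sub_mem_pow]
  intro f hf
  have hle {n k : ℕ} (hk : n ≤ k) : f k - f n ∈ I ^ n := by
    induction k, hk using Nat.le_induction with
    | base => simp
    | succ k hk ih => simpa using add_mem (Ideal.pow_le_pow_right hk (hf k)) ih
  obtain ⟨L, hL⟩ := (isPrecomplete_iff_exists_sub_mem_pow _).mp ‹_› f fun n =>
    Ideal.pow_right_mono hI n (hf n)
  refine ⟨L, fun n => mem_of_forall_mem_sup_maximalIdeal_pow fun k => ?_⟩
  rw [← sub_add_sub_cancel L (f (max n k))]
  exact add_mem (Ideal.mem_sup_right (Ideal.pow_le_pow_right (le_max_right n k) (hL _)))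
    (Ideal.mem_sup_left (hle (le_max_left n k)))

end NoetherianLocal

theorem exists_forall_mem_pow_of_mul_mem_pow {B : Type*} [CommRing B] [IsNoetherianRing B]
    [IsDomain B] (I : Ideal B) {a : B} (ha : a ≠ 0) :
    ∃ k, ∀ n x, a * x ∈ I ^ (n + k) → x ∈ I ^ n := by
  obtain ⟨k, hk⟩ := I.exists_pow_inf_eq_pow_smul (M := B) (Ideal.span {a})
  refine ⟨k, fun n x hx => ?_⟩
  have hinf : a * x ∈ I ^ (n + k) • (⊤ : Submodule B B) ⊓ Ideal.span {a} :=
    ⟨by simpa using hx, Ideal.mul_mem_right _ _ (Ideal.mem_span_singleton_self a)⟩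
  rw [hk _ (Nat.le_add_left k n), Nat.add_sub_cancel] at hinf
  have hmul : a * x ∈ I ^ n * Ideal.span {a} := Submodule.smul_mono le_rfl inf_le_right hinf
  obtain ⟨y, hy, hya⟩ := Ideal.mem_mul_span_singleton.mp hmul
  rw [mul_comm y] at hya
  rwa [← mul_left_cancel₀ ha hya]

section CoefficientSubring

open MvPolynomial WittVector

variable {B ι : Type*} [CommRing B] [IsLocalRing B] {p : ℕ} [hp : Fact p.Prime] {c : ι → B}

theorem mem_coefficientSubring_of_forall_sub_mem {L : B} {s : ℕ → B}
    (hs : ∀ n, s n ∈ coefficientSubring p c) (hL : ∀ n, L - s n ∈ maximalIdeal B ^ n) :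
    L ∈ coefficientSubring p c :=
  mem_coefficientSubring.mpr fun n =>
    mem_ghostApprox_of_sub_mem (mem_coefficientSubring.mp (hs (n + 1)) n) (hL (n + 1))

variable [CharP (ResidueField B) p]

theorem exists_mem_coefficientSubring_sub_mem [IsPrecomplete (maximalIdeal B) B]
    (hc : IsPBasis p fun i => residue B (c i)) (b : B) :
    ∃ r ∈ coefficientSubring p c, b - r ∈ maximalIdeal B := by
  have hb : b ∈ ghostApprox p c 0 :=
    mem_ghostApprox.mpr ⟨C (teichmuller p b), by simp [ghostEval, ghostComponent_teichmuller]⟩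
  choose next hnext hsub using fun (n : ℕ) (y : ghostApprox p c n) =>
    exists_mem_ghostApprox_succ_sub_mem hc y.2
  let s (n : ℕ) : ghostApprox p c n := Nat.rec ⟨b, hb⟩ (fun n y => ⟨next n y, hnext n y⟩) n
  have hs (n : ℕ) : (s (n + 1)).1 - (s n).1 ∈ maximalIdeal B ^ (n + 1) := hsub n (s n)
  obtain ⟨L, hL⟩ := (isPrecomplete_iff_exists_sub_mem_pow _).mp ‹_› (fun n => (s n).1) fun n =>
    Ideal.pow_le_pow_right (Nat.le_succ n) (hs n)
  have hLs (n : ℕ) : L - (s n).1 ∈ maximalIdeal B ^ (n + 1) := by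
    simpa using add_mem (hL (n + 1)) (hs n)
  refine ⟨L, mem_coefficientSubring.mpr fun n => mem_ghostApprox_of_sub_mem (s n).2 (hLs n), ?_⟩
  rw [← neg_mem_iff, neg_sub, ← pow_one (maximalIdeal B)]
  exact hLs 0

theorem isUnit_coefficientSubring [IsPrecomplete (maximalIdeal B) B]
    (hc : IsPBasis p fun i => residue B (c i)) (y : coefficientSubring p c)
    (hy : (y : B) ∉ maximalIdeal B) : IsUnit y := by
  obtain ⟨u, hu⟩ := (notMem_maximalIdeal.mp hy).exists_right_inv
  obtain ⟨μ, hμ, huμ⟩ := exists_mem_coefficientSubring_sub_mem hc u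
  set ν : B := 1 - y * μ with hν
  have hνm : ν ∈ maximalIdeal B := by
    have := Ideal.mul_mem_left _ (y : B) huμ
    rwa [mul_sub, hu] at this
  have hνc : ν ∈ coefficientSubring p c := sub_mem (one_mem _) (mul_mem y.2 hμ)
  have huc : u ∈ coefficientSubring p c := by
    refine mem_coefficientSubring_of_forall_sub_mem
      (s := fun n => μ * ∑ i ∈ Finset.range n, ν ^ i)
      (fun n => mul_mem hμ (sum_mem fun i _ => pow_mem hνc i)) fun n => ?_
    have hgeom : (∑ i ∈ Finset.range n, ν ^ i) * (1 - ν) = 1 - ν ^ n := geom_sum_mul_neg ν n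
    have hsub : u - μ * ∑ i ∈ Finset.range n, ν ^ i = u * ν ^ n := by
      linear_combination (-u) * hgeom + (∑ i ∈ Finset.range n, ν ^ i) * (μ * hu + u * hν)
    rw [hsub]
    exact Ideal.mul_mem_left _ _ (Ideal.pow_mem_pow hνm n)
  exact .of_mul_eq_one ⟨u, huc⟩ (Subtype.ext hu)

variable [IsNoetherianRing B] [IsDomain B]

theorem natCast_dvd_of_mem_maximalIdeal (hc : IsPBasis p fun i => residue B (c i))
    {y : coefficientSubring p c} (hym : (y : B) ∈ maximalIdeal B) :
    (p : coefficientSubring p c) ∣ y := by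
  obtain ⟨y, hy⟩ := y
  choose μ hμ hyμ using fun n =>
    exists_mem_ghostApprox_sub_natCast_mul_mem hc (mem_coefficientSubring.mp hy n) hym
  have hpy : y ∈ Ideal.span {(p : B)} := by
    refine mem_of_forall_mem_sup_maximalIdeal_pow fun n => ?_
    rw [← sub_add_cancel y (p * μ n)]
    exact add_mem (Ideal.mem_sup_right (Ideal.pow_le_pow_right (Nat.le_succ n) (hyμ n)))
      (Ideal.mem_sup_left (Ideal.mul_mem_right _ _ (Ideal.mem_span_singleton_self _)))
  obtain ⟨z, rfl⟩ := Ideal.mem_span_singleton.mp hpy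
  by_cases hp0 : (p : B) = 0
  · exact ⟨0, Subtype.ext (by simp [hp0])⟩
  obtain ⟨k, hk⟩ := exists_forall_mem_pow_of_mul_mem_pow (maximalIdeal B) hp0
  refine ⟨⟨z, mem_coefficientSubring.mpr fun n => ?_⟩, rfl⟩
  refine mem_ghostApprox_of_sub_mem (ghostApprox_antitone (Nat.le_add_right n k) (hμ (n + k))) ?_
  refine hk _ _ ?_
  rw [mul_sub, add_right_comm]
  exact hyμ (n + k)

theorem natCast_pow_dvd_of_coe_dvd (hc : IsPBasis p fun i => residue B (c i)) (hp0 : (p : B) ≠ 0)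
    {n : ℕ} {y : coefficientSubring p c} (hy : (p : B) ^ n ∣ y) :
    (p : coefficientSubring p c) ^ n ∣ y := by
  induction n generalizing y with
  | zero => simp
  | succ n ih =>
    obtain ⟨z, rfl⟩ := natCast_dvd_of_mem_maximalIdeal hc <|
      Ideal.mem_of_dvd _ ((dvd_pow_self _ n.succ_ne_zero).trans hy) natCast_mem_maximalIdeal
    rw [pow_succ']
    refine mul_dvd_mul_left _ (ih ?_)
    rw [pow_succ'] at hy
    exact (mul_dvd_mul_iff_left hp0).mp (by simpa using hy)

theorem prime_natCast_coefficientSubring (hc : IsPBasis p fun i => residue B (c i))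
    (hp0 : (p : B) ≠ 0) : Prime (p : coefficientSubring p c) := by
  have hpm : (p : B) ∈ maximalIdeal B := natCast_mem_maximalIdeal
  refine ⟨fun h => hp0 (by simpa using congrArg Subtype.val h), fun h => ?_, fun a b hab => ?_⟩
  · exact (mem_maximalIdeal _).mp hpm (by simpa using h.map (coefficientSubring p c).subtype)
  · obtain ⟨e, he⟩ := hab
    have hmem : (a : B) * b ∈ maximalIdeal B := by
      rw [← Subring.coe_mul, he]
      simpa using Ideal.mul_mem_right (e : B) _ hpm
    exact ((maximalIdeal.isMaximal B).isPrime.mem_or_mem hmem).imp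
      (natCast_dvd_of_mem_maximalIdeal hc) (natCast_dvd_of_mem_maximalIdeal hc)

variable [IsPrecomplete (maximalIdeal B) B]

theorem exists_associated_natCast_pow_of_notMem (hc : IsPBasis p fun i => residue B (c i)) {m : ℕ}
    {y : coefficientSubring p c} (hy : (y : B) ∉ maximalIdeal B ^ m) :
    ∃ n : ℕ, Associated ((p : coefficientSubring p c) ^ n) y := by
  induction m generalizing y with
  | zero => simp at hy
  | succ m ih =>
    by_cases hym : (y : B) ∈ maximalIdeal B
    · obtain ⟨z, rfl⟩ := natCast_dvd_of_mem_maximalIdeal hc hym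
      obtain ⟨n, hn⟩ := ih (y := z) fun hz => hy <| by
        rw [pow_succ']
        simpa using Ideal.mul_mem_mul natCast_mem_maximalIdeal hz
      exact ⟨n + 1, pow_succ' (p : coefficientSubring p c) n ▸ hn.mul_left _⟩
    · refine ⟨0, ?_⟩
      rw [pow_zero]
      exact (associated_one_iff_isUnit.mpr (isUnit_coefficientSubring hc y hym)).symm

theorem exists_associated_natCast_pow (hc : IsPBasis p fun i => residue B (c i))
    {y : coefficientSubring p c} (hy : y ≠ 0) :
    ∃ n : ℕ, Associated ((p : coefficientSubring p c) ^ n) y := by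
  by_contra hassoc
  have : IsHausdorff (maximalIdeal B) B := .of_le_jacobson _ _ (maximalIdeal_le_jacobson _)
  refine hy (Subtype.ext (this.haus' _ fun n => ?_))
  rw [SModEq.zero, smul_eq_mul, Ideal.mul_top]
  by_contra hn
  exact hassoc (exists_associated_natCast_pow_of_notMem hc hn)

theorem isField_coefficientSubring (hc : IsPBasis p fun i => residue B (c i))
    (hp0 : (p : B) = 0) : IsField (coefficientSubring p c) where
  exists_pair_ne := ⟨0, 1, zero_ne_one⟩
  mul_comm := mul_comm
  mul_inv_cancel {y} hy := by
    refine (isUnit_coefficientSubring hc y fun hym => hy ?_).exists_right_inv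
    obtain ⟨z, rfl⟩ := natCast_dvd_of_mem_maximalIdeal hc hym
    exact Subtype.ext (by simp [hp0])

theorem isPrecomplete_span_natCast_coefficientSubring (hc : IsPBasis p fun i => residue B (c i))
    (hp0 : (p : B) ≠ 0) :
    IsPrecomplete (Ideal.span {(p : coefficientSubring p c)}) (coefficientSubring p c) := by
  have hle : Ideal.span {(p : B)} ≤ maximalIdeal B :=
    (Ideal.span_singleton_le_iff_mem _).mpr natCast_mem_maximalIdeal
  rw [isPrecomplete_iff_exists_sub_mem_pow]
  intro f hf
  simp only [Ideal.span_singleton_pow, Ideal.mem_span_singleton] at hf ⊢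
  obtain ⟨L, hL⟩ :=
    (isPrecomplete_iff_exists_sub_mem_pow _).mp (isPrecomplete_of_le_maximalIdeal hle)
    (fun n => (f n : B)) fun n => by
      rw [Ideal.span_singleton_pow, Ideal.mem_span_singleton]
      simpa using map_dvd (coefficientSubring p c).subtype (hf n)
  have hLc : L ∈ coefficientSubring p c := mem_coefficientSubring_of_forall_sub_mem
    (fun n => (f n).2) fun n => Ideal.pow_right_mono hle n (hL n)
  refine ⟨⟨L, hLc⟩, fun n => natCast_pow_dvd_of_coe_dvd hc hp0 ?_⟩
  rw [← Ideal.mem_span_singleton, ← Ideal.span_singleton_pow]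
  exact hL n

theorem isNormalCover_coefficientSubring (hc : IsPBasis p fun i => residue B (c i))
    (hp0 : (p : B) ≠ 0) : IsNormalCover (coefficientSubring p c).subtype
      (Ideal.span {(coefficientSubring p c).subtype p}) 1 := by
  have hprime := prime_natCast_coefficientSubring hc hp0
  have : IsDiscreteValuationRing (coefficientSubring p c) :=
    .ofHasUnitMulPowIrreducibleFactorization
      ⟨p, hprime.irreducible, fun hy => exists_associated_natCast_pow hc hy⟩
  have hmax : maximalIdeal (coefficientSubring p c) = Ideal.span {(p : coefficientSubring p c)} :=
    hprime.irreducible.maximalIdeal_eq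
  refine ⟨inferInstance, inferInstance, inferInstance, inferInstance, ?_, ?_, ?_, fun b => ?_⟩
  · rw [hmax]
    exact isPrecomplete_span_natCast_coefficientSubring hc hp0
  · rw [IsDiscreteValuationRing.ringKrullDim_eq_one, Nat.cast_one]
  · rw [hmax, Ideal.map_span, Set.image_singleton]
  · obtain ⟨r, hr, hbr⟩ := exists_mem_coefficientSubring_sub_mem hc b
    exact ⟨⟨r, hr⟩, hbr⟩

end CoefficientSubring

theorem hasCoefficientRing_of_isAdicComplete (B : Type*) [CommRing B] [IsLocalRing B]
    [IsDomain B] [IsNoetherianRing B] [IsAdicComplete (maximalIdeal B) B] :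
    HasCoefficientRing B := by
  obtain ⟨p, hchar⟩ := CharP.exists (ResidueField B)
  rcases CharP.char_is_prime_or_zero (ResidueField B) p with hp | rfl
  · have : Fact p.Prime := ⟨hp⟩
    obtain ⟨T, hT⟩ := exists_isPBasis (ResidueField B) p
    choose σ hσ using residue_surjective (R := B)
    have hc : IsPBasis p fun i : T => residue B (σ i) := by simpa only [hσ] using hT
    refine ⟨coefficientSubring p fun i : T => σ i, inferInstance, Subring.subtype _, ?_⟩
    by_cases hp0 : (p : B) = 0
    · refine .inl (isNormalCover_of_isField (isField_coefficientSubring hc hp0) _ fun b => ?_)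
      obtain ⟨r, hr, hbr⟩ := exists_mem_coefficientSubring_sub_mem hc b
      exact ⟨⟨r, hr⟩, hbr⟩
    · exact .inr ⟨p, prime_natCast_coefficientSubring hc hp0, by simpa using hp0,
        by simpa using natCast_mem_maximalIdeal (B := B) (p := p),
        isNormalCover_coefficientSubring hc hp0⟩
  · have := CharP.charP_to_charZero (ResidueField B)
    exact hasCoefficientRing_of_charZero B

/-! ### The dimension formula -/

/-- The dimension formula `dim (A / P) + ht P = dim A` for all primes `P`, which holds for instance
in a catenary equidimensional local ring. -/
def SatisfiesDimensionFormula (A : Type*) [CommRing A] : Prop :=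
  ∀ P : Ideal A, P.IsPrime → ringKrullDim (A ⧸ P) + P.height = ringKrullDim A

theorem ringKrullDim_quotient_add_height_le {A : Type*} [CommRing A] (I : Ideal A) :
    ringKrullDim (A ⧸ I) + I.height ≤ ringKrullDim A := by
  rw [ringKrullDim_quotient]
  rcases isEmpty_or_nonempty (PrimeSpectrum.zeroLocus (I : Set A)) with h | h
  · rw [Order.krullDim_eq_bot, WithBot.bot_add]
    exact bot_le
  have : Nonempty (PrimeSpectrum A) := h.map Subtype.val
  rw [Order.krullDim_eq_iSup_coheight_of_nonempty, ringKrullDim,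
    Order.krullDim_eq_iSup_height_add_coheight_of_nonempty]
  norm_cast
  rw [ENat.iSup_add]
  refine iSup_le fun x => le_iSup_of_le x.1 ?_
  rw [add_comm]
  gcongr
  · rw [← PrimeSpectrum.height_eq_orderHeight]
    exact Ideal.height_mono x.2
  · exact Order.coheight_le_coheight_apply_of_strictMono _ (Subtype.strictMono_coe _) x

theorem height_le_height_comap_of_surjective {A B : Type*} [CommRing A] [CommRing B] {f : A →+* B}
    (hf : Function.Surjective f) (P : Ideal B) [P.IsPrime] : P.height ≤ (P.comap f).height := by
  have hmono : StrictMono (PrimeSpectrum.comap f) :=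
    Monotone.strictMono_of_injective (fun _ _ h => Ideal.comap_mono h)
      (PrimeSpectrum.comap_injective_of_surjective _ hf)
  have := Order.height_le_height_apply_of_strictMono _ hmono ⟨P, ‹_›⟩
  rwa [← PrimeSpectrum.height_eq_orderHeight, ← PrimeSpectrum.height_eq_orderHeight] at this

theorem exists_height_eq_one_le_of_ne_bot {B : Type*} [CommRing B] [IsDomain B] [IsNoetherianRing B]
    {P : Ideal B} [P.IsPrime] (hP : P ≠ ⊥) : ∃ q ≤ P, q.IsPrime ∧ q.height = 1 := by
  obtain ⟨a, haP, ha⟩ := Submodule.exists_mem_ne_zero_of_ne_bot hP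
  obtain ⟨q, hq, hqP⟩ := Ideal.exists_minimalPrimes_le
    ((Ideal.span_singleton_le_iff_mem P).mpr haP)
  have := hq.1.1
  refine ⟨q, hqP, this,
    (Ideal.height_le_one_of_isPrincipal_of_mem_minimalPrimes _ _ hq).antisymm ?_⟩
  rw [Order.one_le_iff_ne_zero, Ne, Ideal.height_eq_zero_iff_eq_bot]
  rintro rfl
  exact ha (by simpa using hq.1.2)

section Complete

variable {A : Type*} [CommRing A] [IsLocalRing A] [IsNoetherianRing A]
  [IsAdicComplete (maximalIdeal A) A]

theorem ringKrullDim_le_ringKrullDim_quotient_add_of_height_le [IsDomain A] (P : Ideal A)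
    [P.IsPrime] (n : ℕ) (hn : P.height ≤ n) : ringKrullDim A ≤ ringKrullDim (A ⧸ P) + n := by
  induction n generalizing A with
  | zero =>
    obtain rfl : P = ⊥ := Ideal.height_eq_zero_iff_eq_bot.mp (by simpa using hn)
    rw [ringKrullDim_eq_of_ringEquiv (RingEquiv.quotientBot A), Nat.cast_zero, add_zero]
  | succ n ih =>
    by_cases hP : P = ⊥
    · rw [hP, ringKrullDim_eq_of_ringEquiv (RingEquiv.quotientBot A)]
      exact le_add_of_nonneg_right (by positivity)
    obtain ⟨q, hqP, _, hq⟩ := exists_height_eq_one_le_of_ne_bot hP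
    have : IsLocalRing (A ⧸ q) := .of_surjective' _ Ideal.Quotient.mk_surjective
    have := isAdicComplete_quotient_of_isLocalRing q
    have : (P.map (Ideal.Quotient.mk q)).IsPrime :=
      Ideal.map_isPrime_of_surjective Ideal.Quotient.mk_surjective (by rwa [Ideal.mk_ker])
    have hheight : (P.map (Ideal.Quotient.mk q)).height ≤ n := by
      have hq0 : q ≠ ⊥ := by
        rintro rfl
        simp at hq
      have := (height_add_one_le_height_comap_mk hq0 (P.map (Ideal.Quotient.mk q))).trans
        ((Ideal.comap_map_mk hqP).symm ▸ hn)
      rw [Nat.cast_add, Nat.cast_one] at this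
      exact (ENat.add_le_add_iff_right ENat.one_ne_top).mp this
    calc ringKrullDim A
      _ ≤ ringKrullDim (A ⧸ q) + 1 :=
        (hasCoefficientRing_of_isAdicComplete A).ringKrullDim_le_of_height_eq_one hq
      _ ≤ ringKrullDim ((A ⧸ q) ⧸ P.map (Ideal.Quotient.mk q)) + n + 1 := by
        gcongr
        exact ih _ hheight
      _ = ringKrullDim (A ⧸ P) + (n + 1 : ℕ) := by
        rw [ringKrullDim_eq_of_ringEquiv (DoubleQuot.quotQuotEquivQuotOfLE hqP), add_assoc,
          Nat.cast_add, Nat.cast_one]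

theorem satisfiesDimensionFormula_of_isDomain [IsDomain A] : SatisfiesDimensionFormula A := by
  refine fun P _ => (ringKrullDim_quotient_add_height_le P).antisymm ?_
  obtain ⟨n, hn⟩ := ENat.ne_top_iff_exists.mp (P.height_ne_top ‹P.IsPrime›.ne_top)
  rw [← hn]
  exact ringKrullDim_le_ringKrullDim_quotient_add_of_height_le P n hn.ge

theorem IsEquidimensionalRing.satisfiesDimensionFormula (hA : IsEquidimensionalRing A) :
    SatisfiesDimensionFormula A := by
  refine fun P _ => (ringKrullDim_quotient_add_height_le P).antisymm ?_
  obtain ⟨p, hp, hpP⟩ := Ideal.exists_minimalPrimes_le (bot_le : ⊥ ≤ P)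
  have := hp.1.1
  have : IsLocalRing (A ⧸ p) := .of_surjective' _ Ideal.Quotient.mk_surjective
  have := isAdicComplete_quotient_of_isLocalRing p
  have : (P.map (Ideal.Quotient.mk p)).IsPrime :=
    Ideal.map_isPrime_of_surjective Ideal.Quotient.mk_surjective (by rwa [Ideal.mk_ker])
  rw [← hA p hp, ← satisfiesDimensionFormula_of_isDomain (P.map (Ideal.Quotient.mk p)) this,
    ringKrullDim_eq_of_ringEquiv (DoubleQuot.quotQuotEquivQuotOfLE hpP)]
  have hheight : (P.map (Ideal.Quotient.mk p)).height ≤ P.height :=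
    (height_le_height_comap_of_surjective Ideal.Quotient.mk_surjective _).trans_eq
      (congrArg _ (Ideal.comap_map_mk hpP))
  exact add_le_add_right (WithBot.coe_le_coe.mpr hheight) _

end Complete

namespace SatisfiesDimensionFormula

variable {A : Type*} [CommRing A] {d t : ℕ}

theorem ringKrullDim_quotient_add_height [IsNoetherianRing A] (hA : SatisfiesDimensionFormula A)
    {I : Ideal A} (hI : I ≠ ⊤) : ringKrullDim (A ⧸ I) + I.height = ringKrullDim A := by
  refine (ringKrullDim_quotient_add_height_le I).antisymm ?_
  obtain ⟨n, hn⟩ := ENat.ne_top_iff_exists.mp (Ideal.height_ne_top hI)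
  obtain ⟨P, hP, hIP, hPn⟩ := Ideal.exists_isPrime_height_eq hn.symm
  rw [← hA P hP, hPn, hn]
  gcongr
  exact ringKrullDim_le_of_surjective (Ideal.Quotient.factor hIP)
    (Ideal.Quotient.factor_surjective hIP)

theorem height_le_iff [IsNoetherianRing A] (hA : SatisfiesDimensionFormula A)
    (hdim : ringKrullDim A = d) (ht : t ≤ d) (I : Ideal A) :
    I.height ≤ t ↔ ((d - t : ℕ) : WithBot ℕ∞) ≤ ringKrullDim (A ⧸ I) := by
  rcases eq_or_ne I ⊤ with rfl | hI
  · have := Ideal.Quotient.subsingleton_iff.mpr (rfl : (⊤ : Ideal A) = ⊤)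
    simp [ringKrullDim_eq_bot_of_subsingleton]
  obtain ⟨n, hn⟩ := ENat.ne_top_iff_exists.mp (Ideal.height_ne_top hI)
  have hformula : ringKrullDim (A ⧸ I) + n = d := by
    rw [← hdim, ← hA.ringKrullDim_quotient_add_height hI, ← hn]
    rfl
  rw [← hn, ← ENat.WithBot.add_le_add_natCast_right_iff (c := n), hformula]
  norm_cast
  omega

end SatisfiesDimensionFormula

/-! ### Connected components of open subsets of the spectrum -/

section Components

variable {A : Type*} [CommRing A]

/-- A minimal prime as a point of the spectrum, that is, the generic point of an irreducible
component. -/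
def minimalPrimePoint (p : minimalPrimes A) : PrimeSpectrum A := ⟨p.1, p.2.1.1⟩

theorem exists_minimalPrimePoint_le (x : PrimeSpectrum A) : ∃ p, minimalPrimePoint p ≤ x := by
  obtain ⟨p, hp, hpx⟩ := Ideal.exists_minimalPrimes_le (bot_le : ⊥ ≤ x.asIdeal)
  exact ⟨⟨p, hp⟩, hpx⟩

theorem minimalPrimePoint_le_iff {p q : minimalPrimes A} :
    minimalPrimePoint p ≤ minimalPrimePoint q ↔ p = q :=
  ⟨fun h => Subtype.ext (le_antisymm (a := p.1) h (q.2.2 p.2.1 h)), fun h => h ▸ le_rfl⟩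

theorem mem_zeroLocus_add_iff {p q : minimalPrimes A} {x : PrimeSpectrum A} :
    x ∈ PrimeSpectrum.zeroLocus ((p.1 + q.1 : Ideal A) : Set A) ↔
      minimalPrimePoint p ≤ x ∧ minimalPrimePoint q ≤ x :=
  sup_le_iff (a := p.1)

theorem zeroLocus_subset_of_isClosed {X : Set (PrimeSpectrum A)} (hX : IsClosed X)
    {x : PrimeSpectrum A} (hx : x ∈ X) : PrimeSpectrum.zeroLocus (x.asIdeal : Set A) ⊆ X :=
  fun y hy => ((PrimeSpectrum.le_iff_specializes x y).mp hy).mem_closed hX hx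

theorem connectedComponents_mk_eq_of_le {X : Set (PrimeSpectrum A)} {x y : X}
    (h : x.1 ≤ y.1) : (x : ConnectedComponents X) = y :=
  (((subtype_specializes_iff x y).mpr ((PrimeSpectrum.le_iff_specializes x.1 y.1).mp h)).map
    ConnectedComponents.continuous_coe).eq

variable (G : SimpleGraph (minimalPrimes A))

variable {G} in
theorem exists_surjective_connectedComponents {X : Set (PrimeSpectrum A)}
    (hX : ∀ p, minimalPrimePoint p ∈ X)
    (hadj : ∀ p q, G.Adj p q → ∃ x ∈ X, minimalPrimePoint p ≤ x ∧ minimalPrimePoint q ≤ x) :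
    ∃ φ : G.ConnectedComponent → ConnectedComponents X, Function.Surjective φ := by
  let c (p : minimalPrimes A) : ConnectedComponents X := (⟨minimalPrimePoint p, hX p⟩ : X)
  have hc : ∀ p q, G.Adj p q → c p = c q := fun p q h => by
    obtain ⟨x, hx, hpx, hqx⟩ := hadj p q h
    have hle {r} (hr : minimalPrimePoint r ≤ x) : c r = (⟨x, hx⟩ : X) :=
      connectedComponents_mk_eq_of_le hr
    rw [hle hpx, hle hqx]
  have hwalk : ∀ p q, G.Walk p q → c p = c q := fun p q w => by
    induction w with
    | nil => rfl
    | cons h _ ih => exact (hc _ _ h).trans ih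
  refine ⟨SimpleGraph.ConnectedComponent.lift c fun p q w _ => hwalk p q w, fun y => ?_⟩
  obtain ⟨x, rfl⟩ := ConnectedComponents.surjective_coe y
  obtain ⟨p, hp⟩ := exists_minimalPrimePoint_le x.1
  exact ⟨G.connectedComponentMk p, connectedComponents_mk_eq_of_le hp⟩

/-- The union of the closed sets `V(p + q)` over the pairs of minimal primes `p`, `q` lying in
distinct connected components of `G`; removing it disconnects these components from each other. -/
def separatingLocus : Set (PrimeSpectrum A) :=
  ⋃ r : {r : minimalPrimes A × minimalPrimes A //
      G.connectedComponentMk r.1 ≠ G.connectedComponentMk r.2},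
    PrimeSpectrum.zeroLocus ((r.1.1.1 + r.1.2.1 : Ideal A) : Set A)

variable {G} in
theorem connectedComponentMk_eq_of_notMem_separatingLocus {x : PrimeSpectrum A}
    (hx : x ∉ separatingLocus G) {p q : minimalPrimes A} (hp : minimalPrimePoint p ≤ x)
    (hq : minimalPrimePoint q ≤ x) : G.connectedComponentMk p = G.connectedComponentMk q := by
  by_contra hne
  exact hx (Set.mem_iUnion.mpr ⟨⟨(p, q), hne⟩, mem_zeroLocus_add_iff.mpr ⟨hp, hq⟩⟩)

theorem minimalPrimePoint_notMem_separatingLocus (p : minimalPrimes A) :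
    minimalPrimePoint p ∉ separatingLocus G := by
  intro hp
  obtain ⟨⟨⟨q, r⟩, hne⟩, h⟩ := Set.mem_iUnion.mp hp
  obtain ⟨hq, hr⟩ := mem_zeroLocus_add_iff.mp h
  exact hne (by rw [minimalPrimePoint_le_iff.mp hq, minimalPrimePoint_le_iff.mp hr])

theorem isClosed_separatingLocus [Finite (minimalPrimes A)] : IsClosed (separatingLocus G) :=
  isClosed_iUnion_of_finite fun _ => PrimeSpectrum.isClosed_zeroLocus _

/-- The connected component of `G` containing the minimal primes below a point outside the
separating locus. -/
noncomputable def componentOf (x : ((separatingLocus G)ᶜ : Set (PrimeSpectrum A))) :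
    G.ConnectedComponent :=
  G.connectedComponentMk (exists_minimalPrimePoint_le x.1).choose

theorem componentOf_eq {x : ((separatingLocus G)ᶜ : Set (PrimeSpectrum A))} {p : minimalPrimes A}
    (hp : minimalPrimePoint p ≤ x.1) : componentOf G x = G.connectedComponentMk p :=
  connectedComponentMk_eq_of_notMem_separatingLocus x.2
    (exists_minimalPrimePoint_le x.1).choose_spec hp

theorem isClosed_preimage_componentOf [Finite (minimalPrimes A)] (s : Set G.ConnectedComponent) :
    IsClosed (componentOf G ⁻¹' s) := by
  have : componentOf G ⁻¹' s = ⋃ p : {p : minimalPrimes A // G.connectedComponentMk p ∈ s},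
      Subtype.val ⁻¹' PrimeSpectrum.zeroLocus (p.1.1 : Set A) := by
    ext x
    simp only [Set.mem_preimage, Set.mem_iUnion]
    constructor
    · exact fun hx => ⟨⟨_, hx⟩, (exists_minimalPrimePoint_le x.1).choose_spec⟩
    · rintro ⟨p, hp⟩
      rw [componentOf_eq G hp]
      exact p.2
  rw [this]
  exact isClosed_iUnion_of_finite fun p =>
    (PrimeSpectrum.isClosed_zeroLocus _).preimage continuous_subtype_val

theorem exists_surjective_connectedComponents_compl_separatingLocus [Finite (minimalPrimes A)] :
    ∃ ψ : ConnectedComponents ((separatingLocus G)ᶜ : Set (PrimeSpectrum A)) →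
      G.ConnectedComponent, Function.Surjective ψ := by
  let : TopologicalSpace G.ConnectedComponent := ⊥
  have : DiscreteTopology G.ConnectedComponent := ⟨rfl⟩
  have hcont : Continuous (componentOf G) :=
    continuous_iff_isClosed.mpr fun s _ => isClosed_preimage_componentOf G s
  refine ⟨hcont.connectedComponentsLift, fun y => ?_⟩
  obtain ⟨p, rfl⟩ := y.exists_rep
  let x : ((separatingLocus G)ᶜ : Set (PrimeSpectrum A)) :=
    ⟨minimalPrimePoint p, minimalPrimePoint_notMem_separatingLocus G p⟩
  exact ⟨x, componentOf_eq G (le_refl x.1)⟩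

end Components

theorem isConnected_of_subsingleton_connectedComponents {T : Type*} [TopologicalSpace T] {s : Set T}
    (hs : s.Nonempty) [Subsingleton (ConnectedComponents s)] : IsConnected s := by
  refine ⟨hs, isPreconnected_iff_preconnectedSpace.mpr ?_⟩
  rw [preconnectedSpace_iff_connectedComponent]
  exact fun x => Set.eq_univ_of_forall fun y =>
    ConnectedComponents.coe_eq_coe'.mp (Subsingleton.elim (y : ConnectedComponents s) x)

/-! ### Dimension of closed subsets of the spectrum -/

section Dimension

variable {A : Type*} [CommRing A]

theorem topologicalKrullDim_zeroLocus (I : Ideal A) :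
    topologicalKrullDim (PrimeSpectrum.zeroLocus (I : Set A)) = ringKrullDim (A ⧸ I) := by
  have hemb := PrimeSpectrum.isClosedEmbedding_comap_of_surjective (A ⧸ I) (Ideal.Quotient.mk I)
    Ideal.Quotient.mk_surjective
  have hrange := range_comap_of_surjective (A ⧸ I) (Ideal.Quotient.mk I)
    Ideal.Quotient.mk_surjective
  rw [Ideal.mk_ker] at hrange
  rw [← hrange, ← hemb.isEmbedding.toHomeomorph.isHomeomorph.topologicalKrullDim_eq,
    PrimeSpectrum.topologicalKrullDim_eq_ringKrullDim]

theorem topologicalKrullDim_eq_krullDim_of_isClosed {X : Set (PrimeSpectrum A)} (hX : IsClosed X) :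
    topologicalKrullDim X = Order.krullDim X := by
  obtain ⟨I, rfl⟩ := (PrimeSpectrum.isClosed_iff_zeroLocus_ideal X).mp hX
  rw [topologicalKrullDim_zeroLocus, ringKrullDim_quotient]

theorem topologicalKrullDim_mono {T : Type*} [TopologicalSpace T] {X Y : Set T} (h : X ⊆ Y) :
    topologicalKrullDim X ≤ topologicalKrullDim Y :=
  (Topology.IsEmbedding.inclusion h).isInducing.topologicalKrullDim_le

theorem topologicalKrullDim_iUnion_le {ι : Type*} [Finite ι] {X : ι → Set (PrimeSpectrum A)}
    (hX : ∀ i, IsClosed (X i)) {n : WithBot ℕ∞} (h : ∀ i, topologicalKrullDim (X i) ≤ n) :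
    topologicalKrullDim (⋃ i, X i : Set (PrimeSpectrum A)) ≤ n := by
  rw [topologicalKrullDim_eq_krullDim_of_isClosed (isClosed_iUnion_of_finite hX)]
  refine iSup_le fun l => ?_
  obtain ⟨i, hi⟩ := Set.mem_iUnion.mp l.head.2
  have hl : ∀ j, (l j : PrimeSpectrum A) ∈ X i := fun j =>
    zeroLocus_subset_of_isClosed (hX i) hi (l.head_le j)
  refine le_trans ?_ (h i)
  rw [topologicalKrullDim_eq_krullDim_of_isClosed (hX i)]
  exact Order.LTSeries.length_le_krullDim (⟨l.length, fun j => ⟨l j, hl j⟩, fun j => l.step j⟩ :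
    LTSeries (X i))

end Dimension

/-! ### Connectedness dimension and the graphs of minimal primes -/

theorem lt_natCast_iff_le_sub_one {a : WithBot ℕ∞} {n : ℕ} (hn : 0 < n) :
    a < n ↔ a ≤ ((n - 1 : ℕ) : WithBot ℕ∞) := by
  rw [← ENat.WithBot.lt_add_one_iff]
  norm_cast
  rw [Nat.sub_add_cancel hn]

section ConnectednessDim

variable (A : Type*) [CommRing A]

theorem isConnected_univ_primeSpectrum [IsLocalRing A] :
    IsConnected (Set.univ : Set (PrimeSpectrum A)) :=
  ⟨⟨closedPoint A, trivial⟩, isPreconnected_of_forall (closedPoint A) fun y _ =>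
    ⟨closure {y}, Set.subset_univ _, (specializes_closedPoint y).mem_closure, subset_closure rfl,
      isPreconnected_singleton.closure⟩⟩

theorem zero_le_connectednessDim [IsLocalRing A] : 0 ≤ connectednessDim A := by
  obtain ⟨X, hX, hXc, hXd⟩ := (connectednessDim_isLeast A).1
  rw [hXd, topologicalKrullDim_eq_krullDim_of_isClosed hX]
  have : Nonempty X := by
    by_contra! hne
    rw [Set.isEmpty_coe_sort.mp hne, Set.compl_empty] at hXc
    exact hXc (isConnected_univ_primeSpectrum A)
  exact Order.krullDim_nonneg

theorem connectednessDim_le_ringKrullDim : connectednessDim A ≤ ringKrullDim A := by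
  refine (connectednessDim_isLeast A).2 ⟨Set.univ, isClosed_univ, by simp [IsConnected], ?_⟩
  rw [← PrimeSpectrum.topologicalKrullDim_eq_ringKrullDim,
    (Homeomorph.Set.univ _).isHomeomorph.topologicalKrullDim_eq]

variable {A}

theorem not_connected_minimalPrimesGraph_zero (h : (minimalPrimes A).Nontrivial) :
    ¬ (minimalPrimesGraph A 0).Connected := by
  intro hconn
  have := h.coe_sort
  obtain ⟨p⟩ := hconn.nonempty
  obtain ⟨q, hpq, hheight⟩ := hconn.preconnected.exists_adj_of_nontrivial p
  obtain ⟨P, hP, hle, hP0⟩ :=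
    Ideal.exists_isPrime_height_eq (I := p.1 + q.1) (n := 0) (by simpa using hheight)
  have hPmin : P ∈ minimalPrimes A := Ideal.height_eq_zero_iff.mp hP0
  have heq (r : minimalPrimes A) (hr : r.1 ≤ P) : r.1 = P := hr.antisymm (hPmin.2 r.2.1 hr)
  exact hpq (Subtype.ext ((heq p (le_sup_left.trans hle)).trans
    (heq q (le_sup_right.trans hle)).symm))

end ConnectednessDim

namespace SatisfiesDimensionFormula

variable {A : Type*} [CommRing A] {d t : ℕ} {X : Set (PrimeSpectrum A)}

theorem minimalPrimePoint_notMem (hA : SatisfiesDimensionFormula A) (hX : IsClosed X)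
    (hXd : topologicalKrullDim X < ringKrullDim A) (p : minimalPrimes A) :
    minimalPrimePoint p ∉ X := by
  intro hp
  have hheight : p.1.height = 0 := by
    have := p.2.1.1
    exact Ideal.height_eq_zero_iff.mpr p.2
  have hle := topologicalKrullDim_mono (zeroLocus_subset_of_isClosed hX hp)
  rw [topologicalKrullDim_zeroLocus, ← add_zero (ringKrullDim _)] at hle
  have := hA p.1 p.2.1.1
  rw [hheight] at this
  exact hXd.not_ge (this ▸ hle)

variable [IsNoetherianRing A]

theorem exists_surjective_connectedComponents_compl (hA : SatisfiesDimensionFormula A)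
    (hdim : ringKrullDim A = d) (ht : t ≤ d) (hX : IsClosed X)
    (hXd : topologicalKrullDim X < ((d - t : ℕ) : WithBot ℕ∞)) :
    ∃ φ : (minimalPrimesGraph A t).ConnectedComponent →
      ConnectedComponents (Xᶜ : Set (PrimeSpectrum A)), Function.Surjective φ := by
  refine exists_surjective_connectedComponents (fun p => ?_) fun p q hpq => ?_
  · refine hA.minimalPrimePoint_notMem hX (hXd.trans_le ?_) p
    rw [hdim]
    exact_mod_cast Nat.sub_le d t
  · have hVd := (hA.height_le_iff hdim ht _).mp hpq.2
    by_contra! hcon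
    rw [← topologicalKrullDim_zeroLocus] at hVd
    refine (hVd.trans (topologicalKrullDim_mono fun x hx => ?_)).not_gt hXd
    have hx' := mem_zeroLocus_add_iff.mp hx
    exact not_not.mp fun hxX => hcon x hxX hx'.1 hx'.2

theorem topologicalKrullDim_separatingLocus_le (hA : SatisfiesDimensionFormula A)
    (hdim : ringKrullDim A = d) (ht : t < d) :
    topologicalKrullDim (separatingLocus (minimalPrimesGraph A t)) ≤
      ((d - t - 1 : ℕ) : WithBot ℕ∞) := by
  have := (minimalPrimes.finite_of_isNoetherianRing A).to_subtype
  refine topologicalKrullDim_iUnion_le (fun _ => PrimeSpectrum.isClosed_zeroLocus _)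
    fun ⟨⟨p, q⟩, hpq⟩ => ?_
  rw [topologicalKrullDim_zeroLocus, ← lt_natCast_iff_le_sub_one (Nat.sub_pos_of_lt ht)]
  by_contra! hle
  exact hpq (SimpleGraph.ConnectedComponent.connectedComponentMk_eq_of_adj
    ⟨fun h => hpq (congrArg _ h), (hA.height_le_iff hdim ht.le _).mpr hle⟩)

theorem isGreatest_card_connectedComponents (hA : SatisfiesDimensionFormula A)
    (hdim : ringKrullDim A = d) (ht : t < d) :
    IsGreatest {n : ℕ∞ | ∃ X : Set (PrimeSpectrum A), IsClosed X ∧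
        topologicalKrullDim X ≤ ((d - t - 1 : ℕ) : WithBot ℕ∞) ∧
        n = ENat.card (ConnectedComponents (Xᶜ : Set (PrimeSpectrum A)))}
      (ENat.card (minimalPrimesGraph A t).ConnectedComponent) := by
  have := (minimalPrimes.finite_of_isNoetherianRing A).to_subtype
  have hle : ∀ X : Set (PrimeSpectrum A), IsClosed X →
      topologicalKrullDim X ≤ ((d - t - 1 : ℕ) : WithBot ℕ∞) →
      ENat.card (ConnectedComponents (Xᶜ : Set (PrimeSpectrum A))) ≤
        ENat.card (minimalPrimesGraph A t).ConnectedComponent := fun X hX hXd => by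
    obtain ⟨φ, hφ⟩ := hA.exists_surjective_connectedComponents_compl hdim ht.le hX
      ((lt_natCast_iff_le_sub_one (Nat.sub_pos_of_lt ht)).mpr hXd)
    exact ENat.card_le_card_of_injective (Function.injective_surjInv hφ)
  constructor
  · have hXd := hA.topologicalKrullDim_separatingLocus_le hdim ht
    have hX := isClosed_separatingLocus (minimalPrimesGraph A t)
    obtain ⟨ψ, hψ⟩ :=
      exists_surjective_connectedComponents_compl_separatingLocus (minimalPrimesGraph A t)
    exact ⟨_, hX, hXd, le_antisymm
      (ENat.card_le_card_of_injective (Function.injective_surjInv hψ)) (hle _ hX hXd)⟩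
  · rintro _ ⟨X, hX, hXd, rfl⟩
    exact hle X hX hXd

theorem le_connectednessDim_of_connected (hA : SatisfiesDimensionFormula A)
    (hdim : ringKrullDim A = d) (ht : t ≤ d) (hG : (minimalPrimesGraph A t).Connected) :
    ((d - t : ℕ) : WithBot ℕ∞) ≤ connectednessDim A := by
  obtain ⟨X, hX, hXc, hXd⟩ := (connectednessDim_isLeast A).1
  rw [hXd]
  by_contra! hlt
  obtain ⟨φ, hφ⟩ := hA.exists_surjective_connectedComponents_compl hdim ht hX hlt
  have := hG.preconnected.subsingleton_connectedComponent
  have := hφ.subsingleton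
  obtain ⟨p⟩ := hG.nonempty
  obtain ⟨x, -⟩ := ConnectedComponents.surjective_coe
    (φ ((minimalPrimesGraph A t).connectedComponentMk p))
  exact hXc (isConnected_of_subsingleton_connectedComponents ⟨x.1, x.2⟩)

theorem connected_of_le_connectednessDim (hA : SatisfiesDimensionFormula A)
    (hdim : ringKrullDim A = d) (ht : t < d)
    (hc : ((d - t : ℕ) : WithBot ℕ∞) ≤ connectednessDim A) :
    (minimalPrimesGraph A t).Connected := by
  have := (minimalPrimes.finite_of_isNoetherianRing A).to_subtype
  have hconn : IsConnected (separatingLocus (minimalPrimesGraph A t))ᶜ := by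
    by_contra hdisc
    refine (hc.trans ((connectednessDim_isLeast A).2
      ⟨_, isClosed_separatingLocus _, hdisc, rfl⟩)).not_gt ?_
    rw [lt_natCast_iff_le_sub_one (Nat.sub_pos_of_lt ht)]
    exact hA.topologicalKrullDim_separatingLocus_le hdim ht
  have := isPreconnected_iff_preconnectedSpace.mp hconn.isPreconnected
  obtain ⟨ψ, hψ⟩ :=
    exists_surjective_connectedComponents_compl_separatingLocus (minimalPrimesGraph A t)
  have := hψ.subsingleton
  obtain ⟨x, -⟩ := hconn.nonempty
  have : Nonempty (minimalPrimes A) := (exists_minimalPrimePoint_le x).nonempty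
  exact ⟨fun p q => SimpleGraph.ConnectedComponent.exact (Subsingleton.elim _ _)⟩

theorem connected_minimalPrimesGraph_iff (hA : SatisfiesDimensionFormula A)
    (hdim : ringKrullDim A = d) (ht : t < d) :
    (minimalPrimesGraph A t).Connected ↔ ((d - t : ℕ) : WithBot ℕ∞) ≤ connectednessDim A :=
  ⟨hA.le_connectednessDim_of_connected hdim ht.le, hA.connected_of_le_connectednessDim hdim ht⟩

theorem connected_minimalPrimesGraph_sub_iff (hA : SatisfiesDimensionFormula A)
    (hdim : ringKrullDim A = d) {i : ℕ} (hi : 0 < i) (hid : i ≤ d) :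
    (minimalPrimesGraph A (d - i)).Connected ↔ (i : WithBot ℕ∞) ≤ connectednessDim A := by
  rw [hA.connected_minimalPrimesGraph_iff hdim (by omega), Nat.sub_sub_self hid]

theorem isGreatest_connectednessDim [IsLocalRing A] (hA : SatisfiesDimensionFormula A)
    (hdim : ringKrullDim A = d) (hmin : (minimalPrimes A).Nontrivial) :
    IsGreatest
      ((fun i : ℕ => (i : WithBot ℕ∞)) ''
        {i : ℕ | i = 0 ∨ (1 ≤ i ∧ i ≤ d - 1 ∧ (minimalPrimesGraph A (d - i)).Connected)})
      (connectednessDim A) := by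
  constructor
  · have hle : connectednessDim A ≤ d := hdim ▸ connectednessDim_le_ringKrullDim A
    obtain ⟨c, hc⟩ := WithBot.ne_bot_iff_exists.mp
      (WithBot.bot_lt_iff_ne_bot.mp ((WithBot.bot_lt_coe 0).trans_le (zero_le_connectednessDim A)))
    obtain ⟨i, rfl⟩ := ENat.ne_top_iff_exists.mp (ne_top_of_le_ne_top (ENat.natCast_ne_top d)
      (WithBot.coe_le_coe.mp (hc.trans_le hle)))
    have hid : i ≤ d := by exact_mod_cast hc.trans_le hle
    refine ⟨i, i.eq_zero_or_pos.imp_right fun hi => ?_, hc⟩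
    have hG := (hA.connected_minimalPrimesGraph_sub_iff hdim hi hid).mpr hc.le
    have hne : i ≠ d := by
      rintro rfl
      exact not_connected_minimalPrimesGraph_zero hmin (by rwa [Nat.sub_self] at hG)
    exact ⟨hi, by omega, hG⟩
  · rintro _ ⟨i, rfl | ⟨hi, hid, hG⟩, rfl⟩
    · exact zero_le_connectednessDim A
    · exact (hA.connected_minimalPrimesGraph_sub_iff hdim hi (by omega)).mp hG

theorem connectednessDim_eq [Nontrivial A] (hA : SatisfiesDimensionFormula A)
    (hdim : ringKrullDim A = d) (hmin : (minimalPrimes A).Subsingleton) :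
    connectednessDim A = d := by
  have := hmin.coe_sort
  have : Nonempty (minimalPrimes A) := Ideal.nonempty_minimalPrimes bot_ne_top
  exact (hdim ▸ connectednessDim_le_ringKrullDim A).antisymm
    (hA.le_connectednessDim_of_connected hdim d.zero_le ⟨.of_subsingleton⟩)

end SatisfiesDimensionFormula

theorem proposition2p2_general {A : Type*} [CommRing A] [IsNoetherianRing A] [IsLocalRing A]
    (hA : SatisfiesDimensionFormula A) (d : ℕ) (hdim : ringKrullDim A = (d : WithBot ℕ∞)) :
    (∀ t : ℕ, t < d →
      ((minimalPrimesGraph A t).Connected ↔ ((d - t : ℕ) : WithBot ℕ∞) ≤ connectednessDim A) ∧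
      IsGreatest
        {n : ℕ∞ | ∃ X : Set (PrimeSpectrum A), IsClosed X ∧
          topologicalKrullDim X ≤ ((d - t - 1 : ℕ) : WithBot ℕ∞) ∧
          n = ENat.card (ConnectedComponents (Xᶜ : Set (PrimeSpectrum A)))}
        (ENat.card (minimalPrimesGraph A t).ConnectedComponent)) ∧
    ((minimalPrimes A).Nontrivial →
      IsGreatest
        ((fun i : ℕ => (i : WithBot ℕ∞)) ''
          {i : ℕ | i = 0 ∨ (1 ≤ i ∧ i ≤ d - 1 ∧ (minimalPrimesGraph A (d - i)).Connected)})
        (connectednessDim A)) ∧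
    ((minimalPrimes A).Subsingleton → connectednessDim A = (d : WithBot ℕ∞)) :=
  ⟨fun _ ht => ⟨hA.connected_minimalPrimesGraph_iff hdim ht,
    hA.isGreatest_card_connectedComponents hdim ht⟩,
    hA.isGreatest_connectednessDim hdim, hA.connectednessDim_eq hdim⟩

theorem proposition2p2 {A : Type*} [CommRing A] [IsNoetherianRing A] [IsLocalRing A]
    [IsAdicComplete (IsLocalRing.maximalIdeal A) A] (hA : IsEquidimensionalRing A)
    (d : ℕ) (hd : 2 ≤ d) (hdim : ringKrullDim A = (d : WithBot ℕ∞)) :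
    (∀ t : ℕ, 1 ≤ t → t ≤ d - 1 →
      ((minimalPrimesGraph A t).Connected ↔ ((d - t : ℕ) : WithBot ℕ∞) ≤ connectednessDim A) ∧
      IsGreatest
        {n : ℕ∞ | ∃ X : Set (PrimeSpectrum A), IsClosed X ∧
          topologicalKrullDim X ≤ ((d - t - 1 : ℕ) : WithBot ℕ∞) ∧
          n = ENat.card (ConnectedComponents (Xᶜ : Set (PrimeSpectrum A)))}
        (ENat.card (minimalPrimesGraph A t).ConnectedComponent)) ∧
    ((minimalPrimes A).Nontrivial →
      IsGreatest
        ((fun i : ℕ => (i : WithBot ℕ∞)) ''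
          {i : ℕ | i = 0 ∨ (1 ≤ i ∧ i ≤ d - 1 ∧ (minimalPrimesGraph A (d - i)).Connected)})
        (connectednessDim A)) ∧
    ((minimalPrimes A).Subsingleton → connectednessDim A = (d : WithBot ℕ∞)) :=
  have ⟨hgraph, hconn⟩ := proposition2p2_general hA.satisfiesDimensionFormula d hdim
  ⟨fun t _ ht => hgraph t (by omega), hconn⟩
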